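/- For integers $a\le b$ write $[\![a,b]\!]=\{a,\dots,b\}$, and $[\![1,0]\!]=\emptyset$. **B-diagrams.** A *B-diagram* is a tuple $G=(n,\lambda,E^\uparrow,E^\downarrow,E)$ where $n\in\mathbb N$; $\lambda=[\lambda_1,\dots,\lambda_n]$ with integers $\lambda_i\ge 1$; $E^\uparrow,E^\downarrow\subseteq[\![1,\omega(G)]\!]$ with $\omega(G)=\lambda_1+\dots+\lambda_n$; and $E\subseteq\{(a,b)\in E^\uparrow\times E^\downarrow: v(a)<v(b)\}$ is such that each $a\in E^\uparrow$ is the first component, and each $b\in E^\downarrow$ the second component, of at most one element of $E$. Here $v(k)=i$ if $\lambda_1+\dots+\lambda_{i-1}<k\le\lambda_1+\dots+\lambda_i$. The elements of $[\![1,n]\!]$ are the vertices; the elements $k$ of $[\![1,\omega(G)]\!]$ label the outer, and likewise the inner, half-edges, those labelled $k$ belonging to the vertex $v(k)$. The free outer half-edges are $H_f^\uparrow(G)=E^\uparrow\setminus\{a:(a,b)\in E\}$ and the free inner half-edges are $H_f^\downarrow(G)=E^\downarrow\setminus\{b:(a,b)\in E\}$. The empty diagram is $\varepsilon=(0,[\,],\emptyset,\emptyset,\emptyset)$.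 **Product.** For B-diagrams $G=(n,\lambda,E^\uparrow,E^\downarrow,E)$ and $G'=(n',\lambda',E'^\uparrow,E'^\downarrow,E')$, elements $a_1<\dots<a_k$ of $H_f^\uparrow(G)$ and distinct elements $b_1,\dots,b_k$ of $H_f^\downarrow(G')$ ($k\ge 0$), the composition of $G$ and $G'$ along $(a_\ell,b_\ell)_{\ell}$ is the B-diagram with $n+n'$ vertices, weights $[\lambda_1,\dots,\lambda_n,\lambda'_1,\dots,\lambda'_{n'}]$, sets of half-edges $E^\uparrow\cup(E'^\uparrow+\omega(G))$ and $E^\downarrow\cup(E'^\downarrow+\omega(G))$, and edges $$E\cup\{(a_\ell,b_\ell+\omega(G)):1\le \ell\le k\}\cup\{(a+\omega(G),b+\omega(G)):(a,b)\in E'\}.$$ Let $\mathcal B$ be the complex vector space with the set of B-diagrams as a basis. The product $\star$ on $\mathcal B$ is the bilinear map such that $G\star G'$ is the sum of the compositions of $G$ and $G'$ along all such families $(a_\ell,b_\ell)_{1\le \ell\le k}$, $k\ge0$. **Coproduct.** For a set $I$ of vertices of $G$, let $S_I=v^{-1}(I)\subseteq[\![1,\omega(G)]\!]$, let $\phi$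 be the increasing bijection of $S_I$ onto $[\![1,\#S_I]\!]$, and let $G[I]$ be the B-diagram with $\#I$ vertices, weights $\lambda_i$ ($i\in I$, in increasing order of $i$), sets of half-edges $\phi(E^\uparrow\cap S_I)$ and $\phi(E^\downarrow\cap S_I)$, and edges $\{(\phi(a),\phi(b)):(a,b)\in E,\ a,b\in S_I\}$. The set $I$ is *isolated* in $G$ if for every $(a,b)\in E$ the vertices $v(a),v(b)$ are both in $I$ or both in $\complement I=[\![1,n]\!]\setminus I$. Let $\Delta:\mathcal B\to\mathcal B\otimes\mathcal B$ be the linear map with $$\Delta(G)=\sum_{I\text{ isolated in }G}G[I]\otimes G[\complement I],$$ and let $\epsilon:\mathcal B\to\mathbb C$ be the linear map with $\epsilon(\varepsilon)=1$ and $\epsilon(G)=0$ for every B-diagram $G\ne\varepsilon$. For $k\in\mathbb N$ let $\mathcal B_k$ be the span of the B-diagrams $G$ with $\omega(G)=k$. **Theorem.** $\mathcal B$, with the product $\star$, the unit $\varepsilon$, the coproduct $\Delta$ and the counit $\epsilon$, is a cocommutative Hopf algebra over $\mathbb C$ (that is, a cocommutative bialgebra which has an antipode). It is graded by $\mathcal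 B=\bigoplus_{k\ge0}\mathcal B_k$, all the structure maps, including the antipode, being homogeneous of degree $0$; it is connected, that is, $\dim\mathcal B_0=1$; and every $\mathcal B_k$ is finite-dimensional. -/

import Mathlib

/-! ## Vertices and half-edges

A list `l = [l₁, …, lₙ]` of weights cuts `{1, …, l₁ + ⋯ + lₙ}` into consecutive blocks, the `i`-th
block being the set of labels of the half-edges of the vertex `i`.  Vertices and half-edges are
numbered from `1`. -/

/-- The vertex carrying the half-edge `k`: the index `i` with
`l₁ + ⋯ + lᵢ₋₁ < k ≤ l₁ + ⋯ + lᵢ` (see `vertexOf_eq_iff`). -/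
def vertexOf : List ℕ → ℕ → ℕ
  | [], _ => 1
  | a :: l, k => if k ≤ a then 1 else vertexOf l (k - a) + 1

theorem vertexOf_pos (l : List ℕ) (k : ℕ) : 1 ≤ vertexOf l k := by
  cases l with
  | nil => simp [vertexOf]
  | cons a l => simp only [vertexOf]; split_ifs <;> omega

theorem vertexOf_eq_iff (l : List ℕ) (k i : ℕ) (hk : k ∈ Finset.Icc 1 l.sum) (hi : 1 ≤ i) :
    vertexOf l k = i ↔ (l.take (i - 1)).sum < k ∧ k ≤ (l.take i).sum := by
  rw [Finset.mem_Icc] at hk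
  induction l generalizing k i with
  | nil => simp at hk; omega
  | cons a l ih =>
    simp only [List.sum_cons] at hk
    obtain ⟨i, rfl⟩ : ∃ j, i = j + 1 := ⟨i - 1, by omega⟩
    simp only [vertexOf, List.take_succ_cons, List.sum_cons, Nat.add_sub_cancel]
    split_ifs with h
    · cases i with
      | zero => simp; omega
      | succ i => simp only [List.take_succ_cons, List.sum_cons]; omega
    · cases i with
      | zero =>
        have := vertexOf_pos l (k - a)
        simp; omega
      | succ i =>
        have := ih (k - a) (i + 1) (by omega) (by omega)
        simp only [Nat.add_sub_cancel] at this
        simp only [List.take_succ_cons, List.sum_cons]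
        omega

theorem vertexOf_append_left (l l' : List ℕ) (k : ℕ) (h1 : 1 ≤ k) (hk : k ≤ l.sum) :
    vertexOf (l ++ l') k = vertexOf l k := by
  induction l generalizing k with
  | nil => simp at hk; omega
  | cons a l ih =>
    simp only [List.sum_cons] at hk
    simp only [List.cons_append, vertexOf]
    split_ifs with h
    · rfl
    · rw [ih _ (by omega) (by omega)]

theorem vertexOf_append_right (l l' : List ℕ) (k : ℕ) (h1 : 1 ≤ k) :
    vertexOf (l ++ l') (k + l.sum) = vertexOf l' k + l.length := by
  induction l with
  | nil => simp
  | cons a l ih =>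
    simp only [List.cons_append, vertexOf, List.sum_cons, List.length_cons]
    rw [if_neg (by omega), show k + (a + l.sum) - a = k + l.sum by omega, ih]
    omega

theorem vertexOf_le (l : List ℕ) (k : ℕ) (h1 : 1 ≤ k) (hk : k ≤ l.sum) :
    vertexOf l k ≤ l.length := by
  induction l generalizing k with
  | nil => simp at hk; omega
  | cons a l ih =>
    simp only [List.sum_cons] at hk
    simp only [vertexOf, List.length_cons]
    split_ifs with h
    · omega
    · have := ih (k - a) (by omega) (by omega)
      omega

/-- The labels of the half-edges whose vertex belongs to `I`. -/
def halfEdgesOf (l : List ℕ) (I : Finset ℕ) : Finset ℕ :=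
  (Finset.Icc 1 l.sum).filter fun k => vertexOf l k ∈ I

/-- On a finite set `S` of integers, `relabel S` is the increasing bijection from `S` onto
`{1, …, #S}`. -/
def relabel (S : Finset ℕ) (k : ℕ) : ℕ := (S.filter (· ≤ k)).card

/-- The weights of the vertices belonging to `I`, in increasing order of the vertices. -/
def subWeights (l : List ℕ) (I : Finset ℕ) : List ℕ :=
  ((l.zipIdx 1).filter fun p => p.2 ∈ I).map Prod.fst

theorem relabel_lt (S : Finset ℕ) {j k : ℕ} (hk : k ∈ S) (h : j < k) :
    relabel S j < relabel S k := by
  apply Finset.card_lt_card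
  rw [Finset.ssubset_iff_of_subset]
  · exact ⟨k, by simp [hk], by simp [h]⟩
  · intro x hx
    simp only [Finset.mem_filter] at hx ⊢
    exact ⟨hx.1, by omega⟩

theorem relabel_injOn (S : Finset ℕ) {j k : ℕ} (hj : j ∈ S) (hk : k ∈ S)
    (h : relabel S j = relabel S k) : j = k := by
  rcases lt_trichotomy j k with h' | h' | h'
  · have := relabel_lt S hk h'; omega
  · exact h'
  · have := relabel_lt S hj h'; omega

theorem relabel_mem_Icc (S : Finset ℕ) {k : ℕ} (hk : k ∈ S) :
    relabel S k ∈ Finset.Icc 1 S.card := by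
  rw [Finset.mem_Icc]
  refine ⟨Finset.card_pos.2 ⟨k, by simp [hk]⟩, Finset.card_le_card (Finset.filter_subset _ _)⟩

theorem subWeights_snoc (l : List ℕ) (a : ℕ) (I : Finset ℕ) :
    subWeights (l ++ [a]) I = subWeights l I ++ (if l.length + 1 ∈ I then [a] else []) := by
  unfold subWeights
  rw [List.zipIdx_append, List.filter_append, List.map_append]
  congr 1
  by_cases h : l.length + 1 ∈ I
  · simp [h, add_comm]
  · simp [h, add_comm]

theorem halfEdgesOf_snoc (l : List ℕ) (a : ℕ) (I : Finset ℕ) :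
    halfEdgesOf (l ++ [a]) I = halfEdgesOf l I ∪
      (if l.length + 1 ∈ I then Finset.Ioc l.sum (l.sum + a) else ∅) := by
  have key : ∀ k, l.sum < k → k ≤ l.sum + a → vertexOf (l ++ [a]) k = l.length + 1 := by
    intro k h1 h2
    have := vertexOf_append_right l [a] (k - l.sum) (by omega)
    rw [show k - l.sum + l.sum = k by omega] at this
    rw [this]
    simp only [vertexOf]
    rw [if_pos (by omega)]
    omega
  ext k
  simp only [halfEdgesOf, Finset.mem_filter, Finset.mem_Icc, List.sum_append, List.sum_cons,
    List.sum_nil, add_zero, Finset.mem_union]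
  by_cases hk : k ≤ l.sum
  · by_cases h1 : 1 ≤ k
    · rw [vertexOf_append_left l [a] k h1 hk]
      split_ifs <;> simp only [Finset.mem_Ioc, Finset.notMem_empty] <;> grind
    · split_ifs <;> simp only [Finset.mem_Ioc, Finset.notMem_empty] <;> grind
  · by_cases h2 : k ≤ l.sum + a
    · rw [key k (by omega) h2]
      split_ifs <;> simp <;> grind
    · split_ifs <;> simp <;> omega

theorem halfEdgesOf_le (l : List ℕ) (I : Finset ℕ) {k : ℕ} (hk : k ∈ halfEdgesOf l I) :
    1 ≤ k ∧ k ≤ l.sum := by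
  simp only [halfEdgesOf, Finset.mem_filter, Finset.mem_Icc] at hk
  exact hk.1

theorem card_halfEdgesOf (l : List ℕ) (I : Finset ℕ) :
    (halfEdgesOf l I).card = (subWeights l I).sum := by
  induction l using List.reverseRecOn with
  | nil => simp [halfEdgesOf, subWeights]
  | append_singleton l a ih =>
    rw [halfEdgesOf_snoc, subWeights_snoc, Finset.card_union_of_disjoint, ih, List.sum_append]
    · split_ifs <;> simp
    · rw [Finset.disjoint_left]
      intro k hk
      have := halfEdgesOf_le l I hk
      split_ifs <;> simp <;> omega

theorem length_subWeights (l : List ℕ) (I : Finset ℕ) :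
    (subWeights l I).length = (I.filter fun i => 1 ≤ i ∧ i ≤ l.length).card := by
  induction l using List.reverseRecOn with
  | nil =>
    simp only [subWeights, List.zipIdx_nil, List.filter_nil, List.map_nil, List.length_nil]
    symm
    rw [Finset.card_eq_zero, Finset.filter_eq_empty_iff]
    intro i _ h
    omega
  | append_singleton l a ih =>
    rw [subWeights_snoc, List.length_append, ih, List.length_append]
    split_ifs with h
    · rw [show (I.filter fun i => 1 ≤ i ∧ i ≤ l.length + [a].length) =
        insert (l.length + 1) (I.filter fun i => 1 ≤ i ∧ i ≤ l.length) by
          ext i; simp only [Finset.mem_filter, Finset.mem_insert, List.length_singleton]; grind]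
      rw [Finset.card_insert_of_notMem (by simp)]
      simp
    · simp only [List.length_nil, add_zero, List.length_singleton]
      congr 1
      ext i
      simp only [Finset.mem_filter]
      grind

/-- After relabelling, the vertex `i ∈ I` becomes the vertex whose number is the rank of `i`. -/
theorem vertexOf_relabel (l : List ℕ) (I : Finset ℕ) {k : ℕ} (hk : k ∈ halfEdgesOf l I) :
    vertexOf (subWeights l I) (relabel (halfEdgesOf l I) k) =
      (I.filter fun i => 1 ≤ i ∧ i ≤ vertexOf l k).card := by
  induction l using List.reverseRecOn with
  | nil => have := halfEdgesOf_le _ _ hk; simp at this; omega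
  | append_singleton l a ih =>
    by_cases hkl : k ≤ l.sum
    · have h1 := (halfEdgesOf_le _ _ hk).1
      have hk' : k ∈ halfEdgesOf l I := by
        rw [halfEdgesOf_snoc] at hk
        rcases Finset.mem_union.1 hk with h | h
        · exact h
        · split_ifs at h
          · simp only [Finset.mem_Ioc] at h; omega
          · simp at h
      have hr : relabel (halfEdgesOf (l ++ [a]) I) k = relabel (halfEdgesOf l I) k := by
        unfold relabel
        congr 1
        rw [halfEdgesOf_snoc, Finset.filter_union]
        rw [Finset.union_eq_left]
        intro j hj
        split_ifs at hj <;> simp at hj; omega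
      have hm := relabel_mem_Icc _ hk'
      rw [card_halfEdgesOf, Finset.mem_Icc] at hm
      rw [hr, subWeights_snoc, vertexOf_append_left _ _ _ hm.1 hm.2, ih hk',
        vertexOf_append_left _ _ _ h1 hkl]
    · have hk2 := hk
      rw [halfEdgesOf_snoc, Finset.mem_union] at hk2
      rcases hk2 with h | h
      · have := halfEdgesOf_le _ _ h; omega
      · split_ifs at h with hI
        · rw [Finset.mem_Ioc] at h
          have hr : relabel (halfEdgesOf (l ++ [a]) I) k =
              (k - l.sum) + (subWeights l I).sum := by
            unfold relabel
            rw [halfEdgesOf_snoc, if_pos hI, Finset.filter_union,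
              Finset.card_union_of_disjoint, Finset.filter_true_of_mem, card_halfEdgesOf,
              show (Finset.Ioc l.sum (l.sum + a)).filter (· ≤ k) = Finset.Ioc l.sum k by
                ext j; simp only [Finset.mem_filter, Finset.mem_Ioc]; omega]
            · simp; omega
            · intro j hj; have := halfEdgesOf_le _ _ hj; omega
            · rw [Finset.disjoint_left]
              intro j hj hj'
              simp only [Finset.mem_filter, Finset.mem_Ioc] at hj hj'
              have := halfEdgesOf_le _ _ hj.1
              omega
          have hv : vertexOf (l ++ [a]) k = l.length + 1 := by
            have := vertexOf_append_right l [a] (k - l.sum) (by omega)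
            rw [show k - l.sum + l.sum = k by omega] at this
            rw [this]
            simp only [vertexOf]
            rw [if_pos (by omega)]
            omega
          rw [hr, hv, subWeights_snoc, if_pos hI, vertexOf_append_right _ _ _ (by omega)]
          simp only [vertexOf]
          rw [if_pos (by omega)]
          have h2 := length_subWeights (l ++ [a]) I
          rw [subWeights_snoc, if_pos hI] at h2
          simp only [List.length_append, List.length_singleton] at h2
          omega
        · simp at h

theorem vertexOf_relabel_lt (l : List ℕ) (I : Finset ℕ) {j k : ℕ}
    (hj : j ∈ halfEdgesOf l I) (hk : k ∈ halfEdgesOf l I) (h : vertexOf l j < vertexOf l k) :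
    vertexOf (subWeights l I) (relabel (halfEdgesOf l I) j) <
      vertexOf (subWeights l I) (relabel (halfEdgesOf l I) k) := by
  rw [vertexOf_relabel l I hj, vertexOf_relabel l I hk]
  apply Finset.card_lt_card
  rw [Finset.ssubset_iff_of_subset]
  · refine ⟨vertexOf l k, ?_, ?_⟩
    · simp only [Finset.mem_filter]
      exact ⟨(Finset.mem_filter.1 hk).2, vertexOf_pos l k, le_rfl⟩
    · simp only [Finset.mem_filter]
      omega
  · intro x hx
    simp only [Finset.mem_filter] at hx ⊢
    exact ⟨hx.1, by omega⟩

theorem subWeights_pos (l : List ℕ) (I : Finset ℕ) (h : ∀ p ∈ l, 0 < p) :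
    ∀ p ∈ subWeights l I, 0 < p := by
  intro p hp
  simp only [subWeights, List.mem_map, List.mem_filter] at hp
  obtain ⟨q, ⟨hq, _⟩, rfl⟩ := hp
  exact h _ (List.fst_mem_of_mem_zipIdx hq)

/-! ## B-diagrams -/

/-- A B-diagram `(n, λ, E↑, E↓, E)`: the number of vertices `n` is the length of the list
`weights = λ`, `outer = E↑` and `inner = E↓` are the sets of uncut outer and inner half-edges, and
`edges = E` is the set of edges, each relying an uncut outer half-edge of a vertex to an uncut
inner half-edge of a later vertex, every half-edge being used at most once. -/
@[ext]
structure BDiagram where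
  weights : List ℕ
  weights_pos : ∀ p ∈ weights, 0 < p
  outer : Finset ℕ
  inner : Finset ℕ
  edges : Finset (ℕ × ℕ)
  outer_subset : outer ⊆ Finset.Icc 1 weights.sum
  inner_subset : inner ⊆ Finset.Icc 1 weights.sum
  edges_spec : ∀ e ∈ edges, e.1 ∈ outer ∧ e.2 ∈ inner ∧
    vertexOf weights e.1 < vertexOf weights e.2
  edges_outer_unique : ∀ e ∈ edges, ∀ f ∈ edges, e.1 = f.1 → e = f
  edges_inner_unique : ∀ e ∈ edges, ∀ f ∈ edges, e.2 = f.2 → e = f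

namespace BDiagram

/-- The number of vertices. -/
def numVertices (G : BDiagram) : ℕ := G.weights.length

/-- The weight `ω(G)`: the number of outer (equivalently, of inner) half-edges. -/
def weight (G : BDiagram) : ℕ := G.weights.sum

/-- The vertex of a half-edge. -/
def vertex (G : BDiagram) (k : ℕ) : ℕ := vertexOf G.weights k

/-- The outer half-edges that are neither cut nor used by an edge. -/
def freeOuter (G : BDiagram) : Finset ℕ := G.outer \ G.edges.image Prod.fst

/-- The inner half-edges that are neither cut nor used by an edge. -/
def freeInner (G : BDiagram) : Finset ℕ := G.inner \ G.edges.image Prod.snd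

/-- The empty diagram `ε`. -/
def empty : BDiagram where
  weights := []
  weights_pos := by simp
  outer := ∅
  inner := ∅
  edges := ∅
  outer_subset := by simp
  inner_subset := by simp
  edges_spec := by simp
  edges_outer_unique := by simp
  edges_inner_unique := by simp

/-- The ways to branch free outer half-edges of `G` to free inner half-edges of `G'`: the set of
pairs `{(a₁, b₁), …, (aₖ, bₖ)}`, `k ≥ 0`, where `a₁ < ⋯ < aₖ` are free outer half-edges of `G` and
`b₁, …, bₖ` are distinct free inner half-edges of `G'`. -/
def branchings (G G' : BDiagram) : Finset (Finset (ℕ × ℕ)) :=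
  (G.freeOuter ×ˢ G'.freeInner).powerset.filter fun M =>
    (∀ e ∈ M, ∀ f ∈ M, e.1 = f.1 → e = f) ∧ (∀ e ∈ M, ∀ f ∈ M, e.2 = f.2 → e = f)

/-- The edges of the composition of `G` and `G'` along the pairs in `M`. -/
def compEdges (G G' : BDiagram) (M : Finset (ℕ × ℕ)) : Finset (ℕ × ℕ) :=
  G.edges ∪ M.image (fun e => (e.1, e.2 + G.weight)) ∪
    G'.edges.image (fun e => (e.1 + G.weight, e.2 + G.weight))

/-- The composition of `G` and `G'` in which, for every pair `(a, b)` of `M`, the outer half-edge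
`a` of `G` is joined to the inner half-edge `b` of `G'`. -/
def comp (G G' : BDiagram) (M : Finset (ℕ × ℕ)) (hM : M ∈ G.branchings G') : BDiagram where
  weights := G.weights ++ G'.weights
  weights_pos := by
    intro p hp
    rcases List.mem_append.1 hp with h | h
    · exact G.weights_pos p h
    · exact G'.weights_pos p h
  outer := G.outer ∪ G'.outer.image (· + G.weight)
  inner := G.inner ∪ G'.inner.image (· + G.weight)
  edges := G.compEdges G' M
  outer_subset := by
    intro k hk
    rw [Finset.mem_Icc, List.sum_append]
    rcases Finset.mem_union.1 hk with h | h
    · have := Finset.mem_Icc.1 (G.outer_subset h); omega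
    · obtain ⟨j, hj, rfl⟩ := Finset.mem_image.1 h
      have := Finset.mem_Icc.1 (G'.outer_subset hj); simp only [weight]; omega
  inner_subset := by
    intro k hk
    rw [Finset.mem_Icc, List.sum_append]
    rcases Finset.mem_union.1 hk with h | h
    · have := Finset.mem_Icc.1 (G.inner_subset h); omega
    · obtain ⟨j, hj, rfl⟩ := Finset.mem_image.1 h
      have := Finset.mem_Icc.1 (G'.inner_subset hj); simp only [weight]; omega
  edges_spec := by
    simp only [branchings, Finset.mem_filter, Finset.mem_powerset] at hM
    intro e he
    simp only [compEdges, Finset.mem_union, Finset.mem_image] at he ⊢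
    rcases he with (he | ⟨f, hf, rfl⟩) | ⟨f, hf, rfl⟩
    · obtain ⟨h1, h2, h3⟩ := G.edges_spec e he
      have k1 := Finset.mem_Icc.1 (G.outer_subset h1)
      have k2 := Finset.mem_Icc.1 (G.inner_subset h2)
      rw [vertexOf_append_left _ _ _ k1.1 k1.2, vertexOf_append_left _ _ _ k2.1 k2.2]
      exact ⟨.inl h1, .inl h2, h3⟩
    · have := Finset.mem_product.1 (hM.1 hf)
      have h1 := (Finset.mem_sdiff.1 this.1).1
      have h2 := (Finset.mem_sdiff.1 this.2).1
      have k1 := Finset.mem_Icc.1 (G.outer_subset h1)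
      have k2 := Finset.mem_Icc.1 (G'.inner_subset h2)
      refine ⟨.inl h1, .inr ⟨_, h2, rfl⟩, ?_⟩
      simp only [weight]
      rw [vertexOf_append_left _ _ _ k1.1 k1.2, vertexOf_append_right _ _ _ k2.1]
      have := vertexOf_le _ _ k1.1 k1.2
      have := vertexOf_pos G'.weights f.2
      omega
    · obtain ⟨h1, h2, h3⟩ := G'.edges_spec f hf
      have k1 := Finset.mem_Icc.1 (G'.outer_subset h1)
      have k2 := Finset.mem_Icc.1 (G'.inner_subset h2)
      refine ⟨.inr ⟨_, h1, rfl⟩, .inr ⟨_, h2, rfl⟩, ?_⟩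
      simp only [weight]
      rw [vertexOf_append_right _ _ _ k1.1, vertexOf_append_right _ _ _ k2.1]
      omega
  edges_outer_unique := by
    simp only [branchings, Finset.mem_filter, Finset.mem_powerset] at hM
    have hG : ∀ e ∈ G.edges, e.1 ≤ G.weight := fun e he =>
      (Finset.mem_Icc.1 (G.outer_subset (G.edges_spec e he).1)).2
    have hG' : ∀ e ∈ G'.edges, 1 ≤ e.1 := fun e he =>
      (Finset.mem_Icc.1 (G'.outer_subset (G'.edges_spec e he).1)).1
    have hMf : ∀ e ∈ M, e.1 ≤ G.weight ∧ ∀ g ∈ G.edges, g.1 ≠ e.1 := by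
      intro e he
      have h := Finset.mem_sdiff.1 (Finset.mem_product.1 (hM.1 he)).1
      exact ⟨(Finset.mem_Icc.1 (G.outer_subset h.1)).2,
        fun g hg hge => h.2 (Finset.mem_image.2 ⟨g, hg, hge⟩)⟩
    intro e he f hf hef
    simp only [compEdges, Finset.mem_union, Finset.mem_image] at he hf
    rcases he with (he | ⟨e, he, rfl⟩) | ⟨e, he, rfl⟩ <;>
      rcases hf with (hf | ⟨f, hf, rfl⟩) | ⟨f, hf, rfl⟩ <;> try simp only at hef
    · exact G.edges_outer_unique e he f hf hef
    · exact absurd hef ((hMf f hf).2 e he)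
    · have := hG e he; have := hG' f hf; omega
    · exact absurd hef.symm ((hMf e he).2 f hf)
    · rw [hM.2.1 e he f hf hef]
    · have := (hMf e he).1; have := hG' f hf; omega
    · have := hG f hf; have := hG' e he; omega
    · have := (hMf f hf).1; have := hG' e he; omega
    · rw [G'.edges_outer_unique e he f hf (by omega)]
  edges_inner_unique := by
    simp only [branchings, Finset.mem_filter, Finset.mem_powerset] at hM
    have hG : ∀ e ∈ G.edges, e.2 ≤ G.weight := fun e he =>
      (Finset.mem_Icc.1 (G.inner_subset (G.edges_spec e he).2.1)).2
    have hG' : ∀ e ∈ G'.edges, 1 ≤ e.2 := fun e he =>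
      (Finset.mem_Icc.1 (G'.inner_subset (G'.edges_spec e he).2.1)).1
    have hMf : ∀ e ∈ M, 1 ≤ e.2 ∧ ∀ g ∈ G'.edges, g.2 ≠ e.2 := by
      intro e he
      have h := Finset.mem_sdiff.1 (Finset.mem_product.1 (hM.1 he)).2
      exact ⟨(Finset.mem_Icc.1 (G'.inner_subset h.1)).1,
        fun g hg hge => h.2 (Finset.mem_image.2 ⟨g, hg, hge⟩)⟩
    intro e he f hf hef
    simp only [compEdges, Finset.mem_union, Finset.mem_image] at he hf
    rcases he with (he | ⟨e, he, rfl⟩) | ⟨e, he, rfl⟩ <;>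
      rcases hf with (hf | ⟨f, hf, rfl⟩) | ⟨f, hf, rfl⟩ <;> try simp only at hef
    · exact G.edges_inner_unique e he f hf hef
    · have := hG e he; have := (hMf f hf).1; omega
    · have := hG e he; have := hG' f hf; omega
    · have := hG f hf; have := (hMf e he).1; omega
    · rw [hM.2.2 e he f hf (by omega)]
    · exact absurd (by omega) ((hMf e he).2 f hf)
    · have := hG f hf; have := hG' e he; omega
    · exact absurd (by omega) ((hMf f hf).2 e he)
    · rw [G'.edges_inner_unique e he f hf (by omega)]

/-- The sub B-diagram `G[I]` on the vertices of `G` belonging to `I`: only the half-edges of these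
vertices and the edges between them are kept, and everything is renumbered increasingly. -/
def sub (G : BDiagram) (I : Finset ℕ) : BDiagram where
  weights := subWeights G.weights I
  weights_pos := subWeights_pos _ _ G.weights_pos
  outer := (G.outer ∩ halfEdgesOf G.weights I).image (relabel (halfEdgesOf G.weights I))
  inner := (G.inner ∩ halfEdgesOf G.weights I).image (relabel (halfEdgesOf G.weights I))
  edges := (G.edges ∩ (halfEdgesOf G.weights I ×ˢ halfEdgesOf G.weights I)).image
    (Prod.map (relabel (halfEdgesOf G.weights I)) (relabel (halfEdgesOf G.weights I)))
  outer_subset := by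
    intro k hk
    obtain ⟨j, hj, rfl⟩ := Finset.mem_image.1 hk
    rw [← card_halfEdgesOf]
    exact relabel_mem_Icc _ (Finset.mem_inter.1 hj).2
  inner_subset := by
    intro k hk
    obtain ⟨j, hj, rfl⟩ := Finset.mem_image.1 hk
    rw [← card_halfEdgesOf]
    exact relabel_mem_Icc _ (Finset.mem_inter.1 hj).2
  edges_spec := by
    intro e he
    obtain ⟨f, hf, rfl⟩ := Finset.mem_image.1 he
    obtain ⟨hf, hS⟩ := Finset.mem_inter.1 hf
    obtain ⟨s1, s2⟩ := Finset.mem_product.1 hS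
    obtain ⟨h1, h2, h3⟩ := G.edges_spec f hf
    exact ⟨Finset.mem_image.2 ⟨_, Finset.mem_inter.2 ⟨h1, s1⟩, rfl⟩,
      Finset.mem_image.2 ⟨_, Finset.mem_inter.2 ⟨h2, s2⟩, rfl⟩,
      vertexOf_relabel_lt _ _ s1 s2 h3⟩
  edges_outer_unique := by
    intro e he f hf hef
    obtain ⟨e, hem, rfl⟩ := Finset.mem_image.1 he
    obtain ⟨f, hfm, rfl⟩ := Finset.mem_image.1 hf
    obtain ⟨heG, hSe⟩ := Finset.mem_inter.1 hem
    obtain ⟨hfG, hSf⟩ := Finset.mem_inter.1 hfm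
    rw [G.edges_outer_unique e heG f hfG (relabel_injOn _ (Finset.mem_product.1 hSe).1
      (Finset.mem_product.1 hSf).1 hef)]
  edges_inner_unique := by
    intro e he f hf hef
    obtain ⟨e, hem, rfl⟩ := Finset.mem_image.1 he
    obtain ⟨f, hfm, rfl⟩ := Finset.mem_image.1 hf
    obtain ⟨heG, hSe⟩ := Finset.mem_inter.1 hem
    obtain ⟨hfG, hSf⟩ := Finset.mem_inter.1 hfm
    rw [G.edges_inner_unique e heG f hfG (relabel_injOn _ (Finset.mem_product.1 hSe).2
      (Finset.mem_product.1 hSf).2 hef)]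

/-- The set of all vertices. -/
def vertices (G : BDiagram) : Finset ℕ := Finset.Icc 1 G.numVertices

/-- The isolated sets of vertices: for every edge, its two ends are both in `I` or both in the
complement of `I`. -/
def isolated (G : BDiagram) : Finset (Finset ℕ) :=
  G.vertices.powerset.filter fun I => ∀ e ∈ G.edges,
    (G.vertex e.1 ∈ I ∧ G.vertex e.2 ∈ I) ∨
      (G.vertex e.1 ∈ G.vertices \ I ∧ G.vertex e.2 ∈ G.vertices \ I)

end BDiagram

/-! ## The algebra and coalgebra of B-diagrams -/

/-- The complex vector space `𝓑` with the B-diagrams as a basis.  It is a type of its own, so that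
the pointwise product of `BDiagram →₀ ℂ` is not an instance on it. -/
def BSpace : Type := BDiagram →₀ ℂ

namespace BSpace

open scoped TensorProduct

noncomputable instance instAddCommGroup : AddCommGroup BSpace :=
  inferInstanceAs (AddCommGroup (BDiagram →₀ ℂ))

noncomputable instance instModule : Module ℂ BSpace :=
  inferInstanceAs (Module ℂ (BDiagram →₀ ℂ))

/-- The basis of B-diagrams. -/
noncomputable def basis : Module.Basis BDiagram ℂ BSpace :=
  Module.Basis.ofRepr (LinearEquiv.refl ℂ (BDiagram →₀ ℂ))

/-- The product `⋆`: on B-diagrams, `G ⋆ G'` is the sum of all the compositions of `G` and `G'`. -/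
noncomputable def star : BSpace →ₗ[ℂ] BSpace →ₗ[ℂ] BSpace :=
  basis.constr ℂ fun G => basis.constr ℂ fun G' =>
    ∑ M ∈ (G.branchings G').attach, basis (G.comp G' M.1 M.2)

/-- The unit: the empty diagram. -/
noncomputable def unit : BSpace := basis BDiagram.empty

/-- The coproduct `Δ`: on B-diagrams, `Δ G` is the sum of `G[I] ⊗ G[∁I]` over the isolated sets
`I` of vertices. -/
noncomputable def coproduct : BSpace →ₗ[ℂ] BSpace ⊗[ℂ] BSpace :=
  basis.constr ℂ fun G => ∑ I ∈ G.isolated, basis (G.sub I) ⊗ₜ[ℂ] basis (G.sub (G.vertices \ I))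

/-- The counit: the coefficient of the empty diagram. -/
noncomputable def counit : BSpace →ₗ[ℂ] ℂ := basis.coord BDiagram.empty

/-- The component `𝓑ₖ` of degree `k`: the span of the B-diagrams of weight `k`. -/
noncomputable def component (k : ℕ) : Submodule ℂ BSpace :=
  Submodule.span ℂ (basis '' {G | G.weight = k})

end BSpace

open scoped TensorProduct in
/-- A family of subspaces is a grading of the Hopf algebra `A` if `A` is its direct sum and all the
structure maps (product, unit, coproduct, counit, antipode) are homogeneous of degree `0`. -/
structure IsHopfGrading {A : Type*} [Ring A] [HopfAlgebra ℂ A] (𝒜 : ℕ → Submodule ℂ A) :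
    Prop where
  isInternal : DirectSum.IsInternal 𝒜
  gradedMonoid : SetLike.GradedMonoid 𝒜
  comul_mem : ∀ k, ∀ x ∈ 𝒜 k, Coalgebra.comul (R := ℂ) x ∈
    ⨆ p ∈ Finset.HasAntidiagonal.antidiagonal k,
      LinearMap.range (TensorProduct.map (𝒜 p.1).subtype (𝒜 p.2).subtype)
  counit_eq_zero : ∀ k, k ≠ 0 → ∀ x ∈ 𝒜 k, Coalgebra.counit (R := ℂ) x = 0
  antipode_mem : ∀ k, ∀ x ∈ 𝒜 k, HopfAlgebra.antipode ℂ x ∈ 𝒜 k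

/-! The argument takes place on sets of half-edges. Since all weights are positive, a diagram is
determined by its weight, the relation "same vertex", its uncut half-edges and its edges
(`ext_of_vertex`). The restriction of `G` to a set `S` of half-edges can therefore be described by a
relation, `IsPart G S H`, without any numbering of vertices. This relation determines `H`
(`IsPart.unique`) and is transitive (`IsPart.isPart_iff`).

Both operations become sums over sets described by restrictions. The product of `G` and `G'` is the
sum, each taken once, of the diagrams `K` that are cut into `G` and `G'` (`IsComp`,
`sum_branchings`): the branching consists of the edges of `K` that cross the cut. The coproduct of
`G` is the sum over the unions `S` of connected components (`closedSets`, `sum_isolated`) of the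
restriction to `S` tensored with the restriction to its complement.

Associativity holds because both bracketings enumerate the diagrams cut into three consecutive
pieces (`sum_comps_assoc`). Coassociativity holds because both sides enumerate the ordered
partitions of the half-edges into three closed sets (`sum_closedSets_assoc`), and cocommutativity is
the exchange of `S` with its complement.

The main point is the compatibility of product and coproduct, `sum_comps_closedSets`. A closed set
of a composition `K` leaves a closed trace on `G` and on `G'`, and the restriction of `K` to it is a
composition of the restrictions of `G` and `G'`; the same holds for the complement. Conversely, such
data glue to exactly one `K`, because no edge joins a closed set to its complement.

The antipode comes from the weight. Only the empty diagram has weight 0, and restriction to a proper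
closed subset lowers the weight, so a left convolution inverse of any map sending the empty diagram
to 1 can be defined by recursion. The left inverse of the identity is again such a map, hence it has
a left inverse itself and is two-sided. Homogeneity holds because weights add up in compositions and
over complementary closed sets. -/

/-! ### Weights, vertices and increasing relabelling. -/

theorem vertexOf_mono (l : List ℕ) {j k : ℕ} (h : j ≤ k) : vertexOf l j ≤ vertexOf l k := by
  induction l generalizing j k with
  | nil => simp [vertexOf]
  | cons a l ih =>
    simp only [vertexOf]
    have := ih (j := j - a) (k := k - a) (by omega)
    split_ifs <;> omega

theorem vertexOf_cons_add (a : ℕ) (l : List ℕ) {k : ℕ} (hk : 1 ≤ k) :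
    vertexOf (a :: l) (k + a) = vertexOf l k + 1 := by
  simp only [vertexOf]
  rw [if_neg (by omega), Nat.add_sub_cancel]

/-- Every vertex of positive weight carries a half-edge. -/
theorem exists_vertexOf_eq (l : List ℕ) (h : ∀ p ∈ l, 0 < p) {i : ℕ} (h1 : 1 ≤ i)
    (hi : i ≤ l.length) : ∃ k ∈ Finset.Icc 1 l.sum, vertexOf l k = i := by
  induction l generalizing i with
  | nil => simp at hi; omega
  | cons a l ih =>
    have ha := h a (by simp)
    by_cases hi1 : i = 1
    · exact ⟨1, by simp; omega, by simp only [vertexOf]; rw [if_pos (by omega), hi1]⟩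
    · obtain ⟨k, hk, hkv⟩ := ih (fun p hp => h p (by simp [hp])) (i := i - 1) (by omega)
        (by simp at hi; omega)
      rw [Finset.mem_Icc] at hk
      refine ⟨k + a, by simp; omega, ?_⟩
      rw [vertexOf_cons_add a l hk.1, hkv]
      omega

/-- Positive weights are determined by the relation of belonging to the same vertex. -/
theorem weights_ext {l l' : List ℕ} (h : ∀ p ∈ l, 0 < p) (h' : ∀ p ∈ l', 0 < p)
    (hs : l.sum = l'.sum)
    (hv : ∀ j ∈ Finset.Icc 1 l.sum, ∀ k ∈ Finset.Icc 1 l.sum,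
      (vertexOf l j = vertexOf l k ↔ vertexOf l' j = vertexOf l' k)) : l = l' := by
  induction l generalizing l' with
  | nil =>
    cases l' with
    | nil => rfl
    | cons b l' => have := h' b (by simp); simp at hs; omega
  | cons a l ih =>
    have ha := h a (by simp)
    cases l' with
    | nil => simp at hs; omega
    | cons b l' =>
      have hb := h' b (by simp)
      simp only [List.sum_cons] at hs hv
      -- If `a < b`, the half-edges `a` and `a + 1` belong to different vertices for the first list
      -- and to the same vertex for the second; the case `b < a` is symmetric.
      have hab : a = b := by
        rcases lt_trichotomy a b with hlt | heq | hlt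
        · have := hv a (by simp; omega) (a + 1) (by simp; omega)
          have h1 := vertexOf_pos l 1
          simp only [vertexOf] at this
          rw [if_pos le_rfl, if_neg (by omega), if_pos (by omega), if_pos (by omega),
            Nat.add_sub_cancel_left] at this
          omega
        · exact heq
        · have := hv b (by simp; omega) (b + 1) (by simp; omega)
          have h1 := vertexOf_pos l' 1
          simp only [vertexOf] at this
          rw [if_pos (by omega), if_pos (by omega), if_pos le_rfl, if_neg (by omega),
            Nat.add_sub_cancel_left] at this
          omega
      subst hab
      refine congrArg _ (ih (fun p hp => h p (by simp [hp])) (fun p hp => h' p (by simp [hp]))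
        (by omega) fun j hj k hk => ?_)
      rw [Finset.mem_Icc] at hj hk
      have := hv (j + a) (by simp; omega) (k + a) (by simp; omega)
      rw [vertexOf_cons_add a l hj.1, vertexOf_cons_add a l hk.1, vertexOf_cons_add a l' hj.1,
        vertexOf_cons_add a l' hk.1] at this
      omega

theorem relabel_le_iff (S : Finset ℕ) {j k : ℕ} (hj : j ∈ S) (hk : k ∈ S) :
    relabel S j ≤ relabel S k ↔ j ≤ k := by
  constructor
  · intro h
    by_contra hlt
    have := relabel_lt S hj (not_le.1 hlt)
    omega
  · intro h
    rcases h.eq_or_lt with rfl | h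
    · rfl
    · exact (relabel_lt S hk h).le

theorem image_relabel (S : Finset ℕ) : S.image (relabel S) = Finset.Icc 1 S.card := by
  apply Finset.eq_of_subset_of_card_le
  · intro k hk
    obtain ⟨j, hj, rfl⟩ := Finset.mem_image.1 hk
    exact relabel_mem_Icc S hj
  · rw [Finset.card_image_of_injOn fun j hj k hk => relabel_injOn S hj hk]
    simp

theorem exists_relabel_eq (S : Finset ℕ) {k : ℕ} (hk : k ∈ Finset.Icc 1 S.card) :
    ∃ j ∈ S, relabel S j = k := by
  rwa [← image_relabel, Finset.mem_image] at hk

theorem mem_image_relabel {S T : Finset ℕ} (hT : T ⊆ S) {k : ℕ} (hk : k ∈ S) :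
    relabel S k ∈ T.image (relabel S) ↔ k ∈ T := by
  rw [Finset.mem_image]
  constructor
  · rintro ⟨j, hj, h⟩
    rwa [← relabel_injOn S (hT hj) hk h]
  · exact fun h => ⟨k, h, rfl⟩

/-- The map `relabel S` is increasing on `S`, so it preserves ranks inside `T`. This is the source
of the transitivity of restriction. -/
theorem relabel_image {S T : Finset ℕ} (hT : T ⊆ S) {k : ℕ} (hk : k ∈ S) :
    relabel (T.image (relabel S)) (relabel S k) = relabel T k := by
  unfold relabel
  rw [Finset.filter_image, Finset.card_image_of_injOn]
  · congr 1
    ext t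
    simp only [Finset.mem_filter]
    exact and_congr_right fun ht => relabel_le_iff S (hT ht) hk
  · intro i hi j hj
    simp only [Finset.coe_filter, Set.mem_ofPred_eq] at hi hj
    exact relabel_injOn S (hT hi.1) (hT hj.1)

theorem card_image_relabel {S T : Finset ℕ} (hT : T ⊆ S) :
    (T.image (relabel S)).card = T.card :=
  Finset.card_image_of_injOn fun _ hi _ hj => relabel_injOn S (hT hi) (hT hj)

/-- Removing elements larger than `k` from `S` does not change the label of `k`. -/
theorem relabel_congr {S T : Finset ℕ} {k : ℕ} (h : ∀ j ≤ k, (j ∈ S ↔ j ∈ T)) :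
    relabel S k = relabel T k := by
  unfold relabel
  congr 1
  ext j
  simp only [Finset.mem_filter]
  constructor <;> rintro ⟨h1, h2⟩
  · exact ⟨(h j h2).1 h1, h2⟩
  · exact ⟨(h j h2).2 h1, h2⟩

theorem relabel_Icc {n k : ℕ} (hk : k ≤ n) : relabel (Finset.Icc 1 n) k = k := by
  unfold relabel
  rw [show (Finset.Icc 1 n).filter (· ≤ k) = Finset.Icc 1 k by
    ext j; simp only [Finset.mem_filter, Finset.mem_Icc]; omega]
  simp

theorem relabel_Ioc {m n k : ℕ} (hk : k ≤ n) : relabel (Finset.Ioc m n) k = k - m := by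
  unfold relabel
  rw [show (Finset.Ioc m n).filter (· ≤ k) = Finset.Ioc m k by
    ext j; simp only [Finset.mem_filter, Finset.mem_Ioc]; omega]
  simp

/-! ### Restriction of a diagram to a set of half-edges. -/

namespace BDiagram

/-- The labels of the half-edges of `G`. -/
def halfEdges (G : BDiagram) : Finset ℕ := Finset.Icc 1 G.weight

theorem card_halfEdges (G : BDiagram) : G.halfEdges.card = G.weight := by simp [halfEdges]

theorem mem_halfEdges {G : BDiagram} {k : ℕ} : k ∈ G.halfEdges ↔ 1 ≤ k ∧ k ≤ G.weight :=
  Finset.mem_Icc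

theorem outer_subset_halfEdges (G : BDiagram) : G.outer ⊆ G.halfEdges := G.outer_subset

theorem inner_subset_halfEdges (G : BDiagram) : G.inner ⊆ G.halfEdges := G.inner_subset

theorem mem_halfEdges_of_mem_edges {G : BDiagram} {j k : ℕ} (h : (j, k) ∈ G.edges) :
    j ∈ G.halfEdges ∧ k ∈ G.halfEdges :=
  ⟨G.outer_subset (G.edges_spec _ h).1, G.inner_subset (G.edges_spec _ h).2.1⟩

theorem vertex_mono (G : BDiagram) {j k : ℕ} (h : j ≤ k) : G.vertex j ≤ G.vertex k :=
  vertexOf_mono _ h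

/-- An edge goes to a strictly later vertex, and the vertex is a monotone function of the label. In
a composition this excludes edges from the right factor back to the left one. -/
theorem lt_of_mem_edges {G : BDiagram} {j k : ℕ} (h : (j, k) ∈ G.edges) : j < k := by
  by_contra hlt
  have h1 := (G.edges_spec _ h).2.2
  have h2 := vertexOf_mono G.weights (not_lt.1 hlt)
  simp only at h1
  omega

/-- Two B-diagrams agree as soon as they have the same weight, the same relation of belonging to
the same vertex, and the same sets of half-edges and edges. -/
theorem ext_of_vertex {G H : BDiagram} (hw : G.weight = H.weight)
    (hv : ∀ j ∈ G.halfEdges, ∀ k ∈ G.halfEdges,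
      (G.vertex j = G.vertex k ↔ H.vertex j = H.vertex k))
    (ho : ∀ j ∈ G.halfEdges, (j ∈ G.outer ↔ j ∈ H.outer))
    (hi : ∀ j ∈ G.halfEdges, (j ∈ G.inner ↔ j ∈ H.inner))
    (he : ∀ j ∈ G.halfEdges, ∀ k ∈ G.halfEdges, ((j, k) ∈ G.edges ↔ (j, k) ∈ H.edges)) :
    G = H := by
  have hh : H.halfEdges = G.halfEdges := by rw [halfEdges, halfEdges, hw]
  apply BDiagram.ext
  · exact weights_ext G.weights_pos H.weights_pos hw hv
  · ext j
    exact ⟨fun h => (ho j (G.outer_subset h)).1 h,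
      fun h => (ho j (hh ▸ H.outer_subset_halfEdges h)).2 h⟩
  · ext j
    exact ⟨fun h => (hi j (G.inner_subset h)).1 h,
      fun h => (hi j (hh ▸ H.inner_subset_halfEdges h)).2 h⟩
  · ext ⟨j, k⟩
    constructor
    · intro h
      have := mem_halfEdges_of_mem_edges h
      exact (he j this.1 k this.2).1 h
    · intro h
      have := mem_halfEdges_of_mem_edges h
      rw [hh] at this
      exact (he j this.1 k this.2).2 h

/-- `H` is the restriction of `G` to the set `S` of half-edges, renumbered increasingly. -/
structure IsPart (G : BDiagram) (S : Finset ℕ) (H : BDiagram) : Prop where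
  subset : S ⊆ G.halfEdges
  weight_eq : H.weight = S.card
  vertex_iff : ∀ j ∈ S, ∀ k ∈ S,
    (H.vertex (relabel S j) = H.vertex (relabel S k) ↔ G.vertex j = G.vertex k)
  outer_iff : ∀ j ∈ S, (relabel S j ∈ H.outer ↔ j ∈ G.outer)
  inner_iff : ∀ j ∈ S, (relabel S j ∈ H.inner ↔ j ∈ G.inner)
  edges_iff : ∀ j ∈ S, ∀ k ∈ S, ((relabel S j, relabel S k) ∈ H.edges ↔ (j, k) ∈ G.edges)

theorem IsPart.exists_eq {G H : BDiagram} {S : Finset ℕ} (h : IsPart G S H) {k : ℕ}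
    (hk : k ∈ H.halfEdges) : ∃ j ∈ S, relabel S j = k :=
  exists_relabel_eq S (by rwa [halfEdges, h.weight_eq] at hk)

theorem IsPart.relabel_mem {G H : BDiagram} {S : Finset ℕ} (h : IsPart G S H) {k : ℕ}
    (hk : k ∈ S) : relabel S k ∈ H.halfEdges := by
  rw [halfEdges, h.weight_eq]
  exact relabel_mem_Icc S hk

theorem IsPart.image_eq {G H : BDiagram} {S : Finset ℕ} (h : IsPart G S H) :
    S.image (relabel S) = H.halfEdges := by
  rw [image_relabel, halfEdges, h.weight_eq]

/-- Every label of `H` is the relabelling of an element of `S`, so `IsPart` prescribes all that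
`ext_of_vertex` compares. -/
theorem IsPart.unique {G H H' : BDiagram} {S : Finset ℕ} (h : IsPart G S H)
    (h' : IsPart G S H') : H = H' := by
  apply ext_of_vertex
  · rw [h.weight_eq, h'.weight_eq]
  · intro _ hj' _ hk'
    obtain ⟨j, hj, rfl⟩ := h.exists_eq hj'
    obtain ⟨k, hk, rfl⟩ := h.exists_eq hk'
    rw [h.vertex_iff j hj k hk, h'.vertex_iff j hj k hk]
  · intro _ hj'
    obtain ⟨j, hj, rfl⟩ := h.exists_eq hj'
    rw [h.outer_iff j hj, h'.outer_iff j hj]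
  · intro _ hj'
    obtain ⟨j, hj, rfl⟩ := h.exists_eq hj'
    rw [h.inner_iff j hj, h'.inner_iff j hj]
  · intro _ hj' _ hk'
    obtain ⟨j, hj, rfl⟩ := h.exists_eq hj'
    obtain ⟨k, hk, rfl⟩ := h.exists_eq hk'
    rw [h.edges_iff j hj k hk, h'.edges_iff j hj k hk]

/-- Restricting in two steps amounts to restricting at once. -/
theorem IsPart.isPart_iff {G H L : BDiagram} {S T : Finset ℕ} (h : IsPart G S H) (hT : T ⊆ S) :
    IsPart H (T.image (relabel S)) L ↔ IsPart G T L := by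
  have hr : ∀ j ∈ T, relabel (T.image (relabel S)) (relabel S j) = relabel T j :=
    fun j hj => relabel_image hT (hT hj)
  have hm : ∀ j ∈ T, relabel S j ∈ T.image (relabel S) :=
    fun j hj => Finset.mem_image_of_mem _ hj
  constructor
  · intro hL
    refine ⟨hT.trans h.subset, by rw [hL.weight_eq, card_image_relabel hT], ?_, ?_, ?_, ?_⟩
    · intro j hj k hk
      rw [← hr j hj, ← hr k hk, hL.vertex_iff _ (hm j hj) _ (hm k hk),
        h.vertex_iff j (hT hj) k (hT hk)]
    · intro j hj
      rw [← hr j hj, hL.outer_iff _ (hm j hj), h.outer_iff j (hT hj)]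
    · intro j hj
      rw [← hr j hj, hL.inner_iff _ (hm j hj), h.inner_iff j (hT hj)]
    · intro j hj k hk
      rw [← hr j hj, ← hr k hk, hL.edges_iff _ (hm j hj) _ (hm k hk),
        h.edges_iff j (hT hj) k (hT hk)]
  · intro hL
    refine ⟨?_, by rw [hL.weight_eq, card_image_relabel hT], ?_, ?_, ?_, ?_⟩
    · rw [← h.image_eq]
      exact Finset.image_subset_image hT
    all_goals simp only [Finset.forall_mem_image]
    · intro j hj k hk
      rw [hr j hj, hr k hk, hL.vertex_iff j hj k hk, h.vertex_iff j (hT hj) k (hT hk)]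
    · intro j hj
      rw [hr j hj, hL.outer_iff j hj, h.outer_iff j (hT hj)]
    · intro j hj
      rw [hr j hj, hL.inner_iff j hj, h.inner_iff j (hT hj)]
    · intro j hj k hk
      rw [hr j hj, hr k hk, hL.edges_iff j hj k hk, h.edges_iff j (hT hj) k (hT hk)]

theorem isPart_halfEdges (G : BDiagram) : IsPart G G.halfEdges G := by
  have hr : ∀ k ∈ G.halfEdges, relabel G.halfEdges k = k :=
    fun k hk => relabel_Icc (mem_halfEdges.1 hk).2
  refine ⟨subset_rfl, G.card_halfEdges.symm, ?_, ?_, ?_, ?_⟩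
  · intro j hj k hk; rw [hr j hj, hr k hk]
  · intro j hj; rw [hr j hj]
  · intro j hj; rw [hr j hj]
  · intro j hj k hk; rw [hr j hj, hr k hk]

/-- Ties the relation `IsPart` to the explicit `sub`. The renumbering of the vertices of `I` is
strictly increasing, so distinct vertices remain distinct. -/
theorem isPart_sub (G : BDiagram) (I : Finset ℕ) :
    IsPart G (halfEdgesOf G.weights I) (G.sub I) := by
  refine ⟨Finset.filter_subset _ _, (card_halfEdgesOf _ _).symm, ?_, ?_, ?_, ?_⟩
  · intro j hj k hk
    constructor
    · intro h
      rcases lt_trichotomy (vertexOf G.weights j) (vertexOf G.weights k) with h' | h' | h'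
      · exact absurd h (vertexOf_relabel_lt _ _ hj hk h').ne
      · exact h'
      · exact absurd h (vertexOf_relabel_lt _ _ hk hj h').ne'
    · intro h
      simp only [vertex, sub] at h ⊢
      rw [vertexOf_relabel _ _ hj, vertexOf_relabel _ _ hk, h]
  · intro j hj
    simp only [sub]
    rw [mem_image_relabel Finset.inter_subset_right hj, Finset.mem_inter]
    exact and_iff_left hj
  · intro j hj
    simp only [sub]
    rw [mem_image_relabel Finset.inter_subset_right hj, Finset.mem_inter]
    exact and_iff_left hj
  · intro j hj k hk
    simp only [sub, Finset.mem_image, Finset.mem_inter, Finset.mem_product, Prod.map, Prod.exists,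
      Prod.mk.injEq]
    constructor
    · rintro ⟨a, b, ⟨hab, ha, hb⟩, h1, h2⟩
      rwa [← relabel_injOn _ ha hj h1, ← relabel_injOn _ hb hk h2]
    · exact fun h => ⟨j, k, ⟨h, hj, hk⟩, rfl, rfl⟩

/-! ### Isolated sets of vertices as closed sets of half-edges. -/

/-- `S` is a union of sets of half-edges of vertices of `G`. -/
structure IsSaturated (G : BDiagram) (S : Finset ℕ) : Prop where
  subset : S ⊆ G.halfEdges
  mem_iff : ∀ j ∈ G.halfEdges, ∀ k ∈ G.halfEdges, G.vertex j = G.vertex k → (j ∈ S ↔ k ∈ S)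

/-- The restriction of `G` to a union of sets of half-edges of vertices. -/
def part (G : BDiagram) (S : Finset ℕ) : BDiagram := G.sub (S.image G.vertex)

theorem halfEdgesOf_image_vertex {G : BDiagram} {S : Finset ℕ} (hS : G.IsSaturated S) :
    halfEdgesOf G.weights (S.image G.vertex) = S := by
  ext k
  simp only [halfEdgesOf, Finset.mem_filter, Finset.mem_image]
  constructor
  · rintro ⟨hk, j, hj, h⟩
    exact (hS.mem_iff j (hS.subset hj) k hk h).1 hj
  · exact fun hk => ⟨hS.subset hk, k, hk, rfl⟩

theorem isPart_part {G : BDiagram} {S : Finset ℕ} (hS : G.IsSaturated S) :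
    IsPart G S (G.part S) := by
  have := G.isPart_sub (S.image G.vertex)
  rwa [halfEdgesOf_image_vertex hS] at this

theorem part_eq {G H : BDiagram} {S : Finset ℕ} (hS : G.IsSaturated S) (h : IsPart G S H) :
    G.part S = H :=
  (isPart_part hS).unique h

/-- The sets of half-edges that are unions of connected components of `G`. -/
def closedSets (G : BDiagram) : Finset (Finset ℕ) :=
  G.halfEdges.powerset.filter fun S => ∀ j ∈ G.halfEdges, ∀ k ∈ G.halfEdges,
    G.vertex j = G.vertex k ∨ (j, k) ∈ G.edges → (j ∈ S ↔ k ∈ S)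

theorem mem_closedSets {G : BDiagram} {S : Finset ℕ} : S ∈ G.closedSets ↔
    S ⊆ G.halfEdges ∧ ∀ j ∈ G.halfEdges, ∀ k ∈ G.halfEdges,
      G.vertex j = G.vertex k ∨ (j, k) ∈ G.edges → (j ∈ S ↔ k ∈ S) := by
  rw [closedSets, Finset.mem_filter, Finset.mem_powerset]

theorem isSaturated_of_mem {G : BDiagram} {S : Finset ℕ} (hS : S ∈ G.closedSets) :
    G.IsSaturated S :=
  ⟨(mem_closedSets.1 hS).1, fun j hj k hk h => (mem_closedSets.1 hS).2 j hj k hk (.inl h)⟩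

theorem isPart_of_mem {G : BDiagram} {S : Finset ℕ} (hS : S ∈ G.closedSets) :
    IsPart G S (G.part S) :=
  isPart_part (isSaturated_of_mem hS)

theorem empty_mem_closedSets (G : BDiagram) : ∅ ∈ G.closedSets := by
  simp [mem_closedSets]

theorem halfEdges_mem_closedSets (G : BDiagram) : G.halfEdges ∈ G.closedSets := by
  rw [mem_closedSets]
  exact ⟨subset_rfl, fun j hj k hk _ => iff_of_true hj hk⟩

theorem sdiff_mem_closedSets {G : BDiagram} {S T : Finset ℕ} (hS : S ∈ G.closedSets)
    (hT : T ∈ G.closedSets) : S \ T ∈ G.closedSets := by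
  rw [mem_closedSets] at *
  refine ⟨Finset.sdiff_subset.trans hS.1, fun j hj k hk h => ?_⟩
  rw [Finset.mem_sdiff, Finset.mem_sdiff, hS.2 j hj k hk h, hT.2 j hj k hk h]

theorem union_mem_closedSets {G : BDiagram} {S T : Finset ℕ} (hS : S ∈ G.closedSets)
    (hT : T ∈ G.closedSets) : S ∪ T ∈ G.closedSets := by
  rw [mem_closedSets] at *
  refine ⟨Finset.union_subset hS.1 hT.1, fun j hj k hk h => ?_⟩
  rw [Finset.mem_union, Finset.mem_union, hS.2 j hj k hk h, hT.2 j hj k hk h]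

theorem compl_mem_closedSets {G : BDiagram} {S : Finset ℕ} (hS : S ∈ G.closedSets) :
    G.halfEdges \ S ∈ G.closedSets :=
  sdiff_mem_closedSets G.halfEdges_mem_closedSets hS

/-- The closed sets of a restriction `G.part S` are those of `G` contained in `S`. -/
theorem image_mem_closedSets_part {G : BDiagram} {S T : Finset ℕ} (hS : S ∈ G.closedSets)
    (hT : T ⊆ S) : T.image (relabel S) ∈ (G.part S).closedSets ↔ T ∈ G.closedSets := by
  have h := isPart_of_mem hS
  have hS' := mem_closedSets.1 hS
  rw [mem_closedSets, mem_closedSets]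
  refine and_congr (iff_of_true ?_ (hT.trans hS'.1)) ?_
  · rw [← h.image_eq]
    exact Finset.image_subset_image hT
  constructor
  · intro H j hj k hk hjk
    have hSS := hS'.2 j hj k hk hjk
    by_cases hjS : j ∈ S
    · have hkS := hSS.1 hjS
      rw [← mem_image_relabel hT hjS, ← mem_image_relabel hT hkS]
      apply H _ (h.relabel_mem hjS) _ (h.relabel_mem hkS)
      rwa [h.vertex_iff j hjS k hkS, h.edges_iff j hjS k hkS]
    · exact iff_of_false (fun hm => hjS (hT hm)) fun hm => hjS (hSS.2 (hT hm))
  · intro H j hj k hk hjk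
    obtain ⟨j, hjS, rfl⟩ := h.exists_eq hj
    obtain ⟨k, hkS, rfl⟩ := h.exists_eq hk
    rw [h.vertex_iff j hjS k hkS, h.edges_iff j hjS k hkS] at hjk
    rw [mem_image_relabel hT hjS, mem_image_relabel hT hkS]
    exact H j (h.subset hjS) k (h.subset hkS) hjk

theorem part_part {G : BDiagram} {S T : Finset ℕ} (hS : S ∈ G.closedSets)
    (hT : T ∈ G.closedSets) (hTS : T ⊆ S) : (G.part S).part (T.image (relabel S)) = G.part T := by
  apply part_eq (isSaturated_of_mem ((image_mem_closedSets_part hS hTS).2 hT))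
  rw [(isPart_of_mem hS).isPart_iff hTS]
  exact isPart_of_mem hT

theorem halfEdges_part_sdiff {G : BDiagram} {S T : Finset ℕ} (hS : S ∈ G.closedSets)
    (hTS : T ⊆ S) :
    (G.part S).halfEdges \ T.image (relabel S) = (S \ T).image (relabel S) := by
  rw [← (isPart_of_mem hS).image_eq, Finset.image_sdiff_of_injOn _ hTS]
  exact fun i hi j hj => relabel_injOn S hi hj

/-- Reindexes the coproduct of a restriction of `G` by closed sets of `G` itself, so that iterated
coproducts can be compared inside a single diagram. -/
theorem sum_closedSets_part {M : Type*} [AddCommMonoid M] {G : BDiagram} {S : Finset ℕ}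
    (hS : S ∈ G.closedSets) (F : BDiagram → BDiagram → M) :
    ∑ T ∈ (G.part S).closedSets, F ((G.part S).part T)
        ((G.part S).part ((G.part S).halfEdges \ T)) =
      ∑ T ∈ G.closedSets with T ⊆ S, F (G.part T) (G.part (S \ T)) := by
  symm
  refine Finset.sum_bij (fun T _ => T.image (relabel S)) ?_ ?_ ?_ ?_
  · intro T hT
    rw [Finset.mem_filter] at hT
    exact (image_mem_closedSets_part hS hT.2).2 hT.1
  · intro T hT T' hT' h
    rw [Finset.mem_filter] at hT hT'
    ext k
    constructor
    · intro hk
      rw [← mem_image_relabel hT'.2 (hT.2 hk), ← h]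
      exact Finset.mem_image_of_mem _ hk
    · intro hk
      rw [← mem_image_relabel hT.2 (hT'.2 hk), h]
      exact Finset.mem_image_of_mem _ hk
  · intro U hU
    -- The preimage of a closed set `U` of the restriction is the subset of `S` sought.
    have hU' : (S.filter fun k => relabel S k ∈ U).image (relabel S) = U := by
      ext k
      simp only [Finset.mem_image, Finset.mem_filter]
      constructor
      · rintro ⟨j, ⟨_, hj⟩, rfl⟩
        exact hj
      · intro hk
        obtain ⟨j, hj, rfl⟩ := (isPart_of_mem hS).exists_eq ((mem_closedSets.1 hU).1 hk)
        exact ⟨j, ⟨hj, hk⟩, rfl⟩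
    refine ⟨S.filter fun k => relabel S k ∈ U, ?_, hU'⟩
    rw [Finset.mem_filter]
    refine ⟨?_, Finset.filter_subset _ _⟩
    rw [← image_mem_closedSets_part hS (Finset.filter_subset _ _), hU']
    exact hU
  · intro T hT
    rw [Finset.mem_filter] at hT
    rw [part_part hS hT.1 hT.2, halfEdges_part_sdiff hS hT.2,
      part_part hS (sdiff_mem_closedSets hS hT.1) Finset.sdiff_subset]

/-- Positivity of the weights is essential: a vertex without half-edges could not be recovered. -/
theorem image_vertex_halfEdgesOf {G : BDiagram} {I : Finset ℕ} (hI : I ⊆ G.vertices) :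
    (halfEdgesOf G.weights I).image G.vertex = I := by
  ext i
  simp only [Finset.mem_image, halfEdgesOf, Finset.mem_filter]
  constructor
  · rintro ⟨k, ⟨_, h⟩, rfl⟩
    exact h
  · intro hi
    have := Finset.mem_Icc.1 (hI hi)
    obtain ⟨k, hk, rfl⟩ := exists_vertexOf_eq G.weights G.weights_pos this.1 this.2
    exact ⟨k, ⟨hk, hi⟩, rfl⟩

theorem vertex_mem_vertices {G : BDiagram} {k : ℕ} (hk : k ∈ G.halfEdges) :
    G.vertex k ∈ G.vertices :=
  Finset.mem_Icc.2 ⟨vertexOf_pos _ _,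
    vertexOf_le _ _ (mem_halfEdges.1 hk).1 (mem_halfEdges.1 hk).2⟩

theorem image_vertex_compl {G : BDiagram} {S : Finset ℕ} (hS : G.IsSaturated S) :
    (G.halfEdges \ S).image G.vertex = G.vertices \ S.image G.vertex := by
  ext i
  simp only [Finset.mem_image, Finset.mem_sdiff]
  constructor
  · rintro ⟨k, ⟨hk, hkS⟩, rfl⟩
    refine ⟨vertex_mem_vertices hk, ?_⟩
    rintro ⟨j, hj, h⟩
    exact hkS ((hS.mem_iff j (hS.subset hj) k hk h).1 hj)
  · rintro ⟨hi, hiS⟩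
    have := Finset.mem_Icc.1 hi
    obtain ⟨k, hk, rfl⟩ := exists_vertexOf_eq G.weights G.weights_pos this.1 this.2
    exact ⟨k, ⟨hk, fun hkS => hiS ⟨k, hkS, rfl⟩⟩, rfl⟩

theorem image_vertex_mem_isolated {G : BDiagram} {S : Finset ℕ} (hS : S ∈ G.closedSets) :
    S.image G.vertex ∈ G.isolated := by
  have hs := isSaturated_of_mem hS
  have key : ∀ k ∈ G.halfEdges, (G.vertex k ∈ S.image G.vertex ↔ k ∈ S) := by
    intro k hk
    rw [Finset.mem_image]
    constructor
    · rintro ⟨j, hj, h⟩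
      exact (hs.mem_iff j (hs.subset hj) k hk h).1 hj
    · exact fun h => ⟨k, h, rfl⟩
  rw [isolated, Finset.mem_filter, Finset.mem_powerset]
  constructor
  · intro i hi
    obtain ⟨k, hk, rfl⟩ := Finset.mem_image.1 hi
    exact vertex_mem_vertices (hs.subset hk)
  · rintro ⟨j, k⟩ h
    have hjk := mem_halfEdges_of_mem_edges h
    have := (mem_closedSets.1 hS).2 j hjk.1 k hjk.2 (.inr h)
    simp only [Finset.mem_sdiff, key j hjk.1, key k hjk.2, vertex_mem_vertices hjk.1,
      vertex_mem_vertices hjk.2]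
    tauto

theorem halfEdgesOf_mem_closedSets {G : BDiagram} {I : Finset ℕ} (hI : I ∈ G.isolated) :
    halfEdgesOf G.weights I ∈ G.closedSets := by
  rw [isolated, Finset.mem_filter, Finset.mem_powerset] at hI
  have key : ∀ k ∈ G.halfEdges, (k ∈ halfEdgesOf G.weights I ↔ G.vertex k ∈ I) := by
    intro k hk
    rw [halfEdgesOf, Finset.mem_filter]
    exact and_iff_right hk
  rw [mem_closedSets]
  refine ⟨Finset.filter_subset _ _, ?_⟩
  intro j hj k hk hjk
  rw [key j hj, key k hk]
  rcases hjk with h | h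
  · rw [h]
  · have := hI.2 _ h
    simp only [Finset.mem_sdiff] at this
    tauto

/-- Taking the half-edges of a set of vertices, and the vertices of a set of half-edges, are inverse
bijections between isolated sets and closed sets, and they respect complements. -/
theorem sum_isolated {M : Type*} [AddCommMonoid M] (G : BDiagram)
    (F : BDiagram → BDiagram → M) :
    ∑ I ∈ G.isolated, F (G.sub I) (G.sub (G.vertices \ I)) =
      ∑ S ∈ G.closedSets, F (G.part S) (G.part (G.halfEdges \ S)) := by
  symm
  refine Finset.sum_bij' (fun S _ => S.image G.vertex) (fun I _ => halfEdgesOf G.weights I)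
    ?_ ?_ ?_ ?_ ?_
  · exact fun S hS => image_vertex_mem_isolated hS
  · exact fun I hI => halfEdgesOf_mem_closedSets hI
  · exact fun S hS => halfEdgesOf_image_vertex (isSaturated_of_mem hS)
  · intro I hI
    rw [isolated, Finset.mem_filter, Finset.mem_powerset] at hI
    exact image_vertex_halfEdgesOf hI.1
  · intro S hS
    rw [part, part, image_vertex_compl (isSaturated_of_mem hS)]

/-! ### Cutting a diagram at a vertex boundary. -/

theorem image_relabel_Ioc {m n p q : ℕ} (h : m + q ≤ n) :
    (Finset.Ioc (m + p) (m + q)).image (relabel (Finset.Ioc m n)) = Finset.Ioc p q := by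
  ext k
  simp only [Finset.mem_image, Finset.mem_Ioc]
  constructor
  · rintro ⟨j, hj, rfl⟩
    rw [relabel_Ioc (by omega)]
    omega
  · intro hk
    exact ⟨m + k, by omega, by rw [relabel_Ioc (by omega)]; omega⟩

/-- Transitivity of restriction for intervals: a block of a block is a block, shifted by `m`. Cuts
into three pieces are compared in this form. -/
theorem IsPart.isPart_Ioc_iff {G H L : BDiagram} {m n p q : ℕ}
    (h : IsPart G (Finset.Ioc m n) H) (hq : m + q ≤ n) :
    IsPart H (Finset.Ioc p q) L ↔ IsPart G (Finset.Ioc (m + p) (m + q)) L := by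
  rw [← h.isPart_iff (Finset.Ioc_subset_Ioc (by omega) hq), image_relabel_Ioc hq]

section Cut

variable {K : BDiagram} {l l' : List ℕ} (hK : K.weights = l ++ l')
include hK

theorem weight_of_append : K.weight = l.sum + l'.sum := by
  rw [weight, hK, List.sum_append]

theorem vertex_left_of_append {k : ℕ} (h1 : 1 ≤ k) (hk : k ≤ l.sum) :
    K.vertex k = vertexOf l k := by
  rw [vertex, hK, vertexOf_append_left l l' k h1 hk]

theorem vertex_right_of_append {k : ℕ} (h1 : 1 ≤ k) :
    K.vertex (k + l.sum) = vertexOf l' k + l.length := by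
  rw [vertex, hK, vertexOf_append_right l l' k h1]

theorem vertex_lt_of_append {j k : ℕ} (hj : 1 ≤ j) (hjl : j ≤ l.sum) (hk : l.sum < k) :
    K.vertex j < K.vertex k := by
  have h1 := vertex_right_of_append hK (k := k - l.sum) (by omega)
  rw [Nat.sub_add_cancel hk.le] at h1
  rw [vertex_left_of_append hK hj hjl, h1]
  have := vertexOf_le l j hj hjl
  have := vertexOf_pos l' (k - l.sum)
  omega

theorem isSaturated_left_of_append : K.IsSaturated (Finset.Ioc 0 l.sum) := by
  have hw := weight_of_append hK
  refine ⟨fun k hk => ?_, fun j hj k hk h => ?_⟩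
  · rw [mem_halfEdges]
    rw [Finset.mem_Ioc] at hk
    omega
  · rw [mem_halfEdges] at hj hk
    rw [Finset.mem_Ioc, Finset.mem_Ioc]
    constructor <;> intro h' <;> by_contra hlt
    · have := vertex_lt_of_append hK (j := j) (k := k) (by omega) (by omega) (by omega)
      omega
    · have := vertex_lt_of_append hK (j := k) (k := j) (by omega) (by omega) (by omega)
      omega

theorem isSaturated_right_of_append : K.IsSaturated (Finset.Ioc l.sum (l.sum + l'.sum)) := by
  have hw := weight_of_append hK
  have h := isSaturated_left_of_append hK
  refine ⟨fun k hk => ?_, fun j hj k hk hjk => ?_⟩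
  · rw [mem_halfEdges]
    rw [Finset.mem_Ioc] at hk
    omega
  · have := h.mem_iff j hj k hk hjk
    rw [mem_halfEdges] at hj hk
    rw [Finset.mem_Ioc, Finset.mem_Ioc] at *
    omega

/-- `H` is known only through its half-edges; on the left block the relation "same vertex" is that
of `l`, and `weights_ext` recovers the list. -/
theorem weights_left_of_append {H : BDiagram} (h : IsPart K (Finset.Ioc 0 l.sum) H) :
    H.weights = l := by
  have hw := h.weight_eq
  rw [Nat.card_Ioc, Nat.sub_zero] at hw
  refine weights_ext H.weights_pos
    (fun p hp => K.weights_pos p (hK ▸ List.mem_append_left _ hp)) hw fun j hj k hk => ?_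
  change j ∈ Finset.Icc 1 H.weight at hj
  change k ∈ Finset.Icc 1 H.weight at hk
  rw [hw, Finset.mem_Icc] at hj hk
  have := h.vertex_iff j (Finset.mem_Ioc.2 (by omega)) k (Finset.mem_Ioc.2 (by omega))
  rwa [relabel_Ioc hj.2, relabel_Ioc hk.2, vertex_left_of_append hK hj.1 hj.2,
    vertex_left_of_append hK hk.1 hk.2] at this

theorem weights_right_of_append {H : BDiagram}
    (h : IsPart K (Finset.Ioc l.sum (l.sum + l'.sum)) H) : H.weights = l' := by
  have hw := h.weight_eq
  rw [Nat.card_Ioc, Nat.add_sub_cancel_left] at hw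
  refine weights_ext H.weights_pos
    (fun p hp => K.weights_pos p (hK ▸ List.mem_append_right _ hp)) hw fun j hj k hk => ?_
  change j ∈ Finset.Icc 1 H.weight at hj
  change k ∈ Finset.Icc 1 H.weight at hk
  rw [hw, Finset.mem_Icc] at hj hk
  have := h.vertex_iff (j + l.sum) (Finset.mem_Ioc.2 (by omega)) (k + l.sum)
    (Finset.mem_Ioc.2 (by omega))
  rw [relabel_Ioc (by omega), relabel_Ioc (by omega), vertex_right_of_append hK hj.1,
    vertex_right_of_append hK hk.1, Nat.add_sub_cancel, Nat.add_sub_cancel,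
    Nat.add_right_cancel_iff] at this
  exact this

end Cut

/-! ### Compositions characterised by their two pieces. -/

/-- `K` is one of the compositions of `G` and `G'`: it is cut into `G` and `G'`. -/
structure IsComp (K G G' : BDiagram) : Prop where
  weights_eq : K.weights = G.weights ++ G'.weights
  left : IsPart K (Finset.Ioc 0 G.weight) G
  right : IsPart K (Finset.Ioc G.weight (G.weight + G'.weight)) G'

namespace IsComp

variable {K K' G G' : BDiagram}

theorem weight_eq (h : IsComp K G G') : K.weight = G.weight + G'.weight :=
  weight_of_append h.weights_eq

theorem halfEdges_cases (h : IsComp K G G') {k : ℕ} (hk : k ∈ K.halfEdges) :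
    k ∈ G.halfEdges ∨ ∃ j ∈ G'.halfEdges, k = j + G.weight := by
  rw [mem_halfEdges, h.weight_eq] at hk
  by_cases hkG : k ≤ G.weight
  · exact .inl (mem_halfEdges.2 ⟨hk.1, hkG⟩)
  · exact .inr ⟨k - G.weight, mem_halfEdges.2 (by omega), by omega⟩

theorem left_mem (h : IsComp K G G') {k : ℕ} (hk : k ∈ G.halfEdges) : k ∈ K.halfEdges := by
  rw [mem_halfEdges] at *
  have := h.weight_eq
  omega

theorem right_mem (h : IsComp K G G') {k : ℕ} (hk : k ∈ G'.halfEdges) :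
    k + G.weight ∈ K.halfEdges := by
  rw [mem_halfEdges] at *
  have := h.weight_eq
  omega

theorem vertex_left (h : IsComp K G G') {k : ℕ} (hk : k ∈ G.halfEdges) :
    K.vertex k = G.vertex k :=
  vertex_left_of_append h.weights_eq (mem_halfEdges.1 hk).1 (mem_halfEdges.1 hk).2

theorem vertex_right (h : IsComp K G G') {k : ℕ} (hk : k ∈ G'.halfEdges) :
    K.vertex (k + G.weight) = G'.vertex k + G.numVertices :=
  vertex_right_of_append h.weights_eq (mem_halfEdges.1 hk).1

theorem vertex_lt (h : IsComp K G G') {j k : ℕ} (hj : j ∈ G.halfEdges) (hk : k ∈ G'.halfEdges) :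
    K.vertex j < K.vertex (k + G.weight) := by
  rw [mem_halfEdges] at hj hk
  have hk' : G.weight < k + G.weight := by omega
  exact vertex_lt_of_append h.weights_eq hj.1 hj.2 hk'

theorem outer_left (h : IsComp K G G') {k : ℕ} (hk : k ∈ G.halfEdges) :
    k ∈ K.outer ↔ k ∈ G.outer := by
  rw [mem_halfEdges] at hk
  have := h.left.outer_iff k (Finset.mem_Ioc.2 (by omega))
  rw [relabel_Ioc (by omega), Nat.sub_zero] at this
  exact this.symm

theorem inner_left (h : IsComp K G G') {k : ℕ} (hk : k ∈ G.halfEdges) :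
    k ∈ K.inner ↔ k ∈ G.inner := by
  rw [mem_halfEdges] at hk
  have := h.left.inner_iff k (Finset.mem_Ioc.2 (by omega))
  rw [relabel_Ioc (by omega), Nat.sub_zero] at this
  exact this.symm

theorem edges_left (h : IsComp K G G') {j k : ℕ} (hj : j ∈ G.halfEdges) (hk : k ∈ G.halfEdges) :
    (j, k) ∈ K.edges ↔ (j, k) ∈ G.edges := by
  rw [mem_halfEdges] at hj hk
  have := h.left.edges_iff j (Finset.mem_Ioc.2 (by omega)) k (Finset.mem_Ioc.2 (by omega))
  rw [relabel_Ioc (by omega), relabel_Ioc (by omega), Nat.sub_zero, Nat.sub_zero] at this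
  exact this.symm

theorem outer_right (h : IsComp K G G') {k : ℕ} (hk : k ∈ G'.halfEdges) :
    k + G.weight ∈ K.outer ↔ k ∈ G'.outer := by
  rw [mem_halfEdges] at hk
  have := h.right.outer_iff (k + G.weight) (Finset.mem_Ioc.2 (by omega))
  rw [relabel_Ioc (by omega), Nat.add_sub_cancel] at this
  exact this.symm

theorem inner_right (h : IsComp K G G') {k : ℕ} (hk : k ∈ G'.halfEdges) :
    k + G.weight ∈ K.inner ↔ k ∈ G'.inner := by
  rw [mem_halfEdges] at hk
  have := h.right.inner_iff (k + G.weight) (Finset.mem_Ioc.2 (by omega))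
  rw [relabel_Ioc (by omega), Nat.add_sub_cancel] at this
  exact this.symm

theorem edges_right (h : IsComp K G G') {j k : ℕ} (hj : j ∈ G'.halfEdges)
    (hk : k ∈ G'.halfEdges) :
    (j + G.weight, k + G.weight) ∈ K.edges ↔ (j, k) ∈ G'.edges := by
  rw [mem_halfEdges] at hj hk
  have := h.right.edges_iff (j + G.weight) (Finset.mem_Ioc.2 (by omega)) (k + G.weight)
    (Finset.mem_Ioc.2 (by omega))
  rw [relabel_Ioc (by omega), relabel_Ioc (by omega), Nat.add_sub_cancel,
    Nat.add_sub_cancel] at this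
  exact this.symm

theorem not_mem_edges {j k : ℕ} (hj : j ∈ G'.halfEdges)
    (hk : k ∈ G.halfEdges) : (j + G.weight, k) ∉ K.edges := by
  intro hjk
  have := lt_of_mem_edges hjk
  rw [mem_halfEdges] at hj hk
  omega

/-- Constructor in terms of the numbering of the half-edges. -/
theorem mk' (hw : K.weights = G.weights ++ G'.weights)
    (ol : ∀ k ∈ G.halfEdges, (k ∈ K.outer ↔ k ∈ G.outer))
    (il : ∀ k ∈ G.halfEdges, (k ∈ K.inner ↔ k ∈ G.inner))
    (el : ∀ j ∈ G.halfEdges, ∀ k ∈ G.halfEdges, ((j, k) ∈ K.edges ↔ (j, k) ∈ G.edges))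
    (or : ∀ k ∈ G'.halfEdges, (k + G.weight ∈ K.outer ↔ k ∈ G'.outer))
    (ir : ∀ k ∈ G'.halfEdges, (k + G.weight ∈ K.inner ↔ k ∈ G'.inner))
    (er : ∀ j ∈ G'.halfEdges, ∀ k ∈ G'.halfEdges,
      ((j + G.weight, k + G.weight) ∈ K.edges ↔ (j, k) ∈ G'.edges)) :
    IsComp K G G' := by
  have hs : K.weight = G.weight + G'.weight := weight_of_append hw
  refine ⟨hw, ?_, ?_⟩
  · have key : ∀ k ∈ Finset.Ioc 0 G.weight,
        k ∈ G.halfEdges ∧ relabel (Finset.Ioc 0 G.weight) k = k := by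
      intro k hk
      have hk' := Finset.mem_Ioc.1 hk
      exact ⟨mem_halfEdges.2 (by omega), relabel_Ioc hk'.2⟩
    refine ⟨fun k hk => ?_, by simp, fun j hj k hk => ?_, fun j hj => ?_, fun j hj => ?_,
      fun j hj k hk => ?_⟩
    · rw [Finset.mem_Ioc] at hk
      rw [mem_halfEdges]
      omega
    · have hj' := mem_halfEdges.1 (key j hj).1
      have hk' := mem_halfEdges.1 (key k hk).1
      rw [(key j hj).2, (key k hk).2, vertex_left_of_append hw hj'.1 hj'.2,
        vertex_left_of_append hw hk'.1 hk'.2, vertex, vertex]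
    · rw [(key j hj).2, ol j (key j hj).1]
    · rw [(key j hj).2, il j (key j hj).1]
    · rw [(key j hj).2, (key k hk).2, el j (key j hj).1 k (key k hk).1]
  · have key : ∀ k ∈ Finset.Ioc G.weight (G.weight + G'.weight), ∃ j ∈ G'.halfEdges,
        k = j + G.weight ∧ relabel (Finset.Ioc G.weight (G.weight + G'.weight)) k = j := by
      intro k hk
      have hk' := Finset.mem_Ioc.1 hk
      exact ⟨k - G.weight, mem_halfEdges.2 (by omega), by omega, relabel_Ioc hk'.2⟩
    refine ⟨fun k hk => ?_, by simp, fun j hj k hk => ?_, fun j hj => ?_, fun j hj => ?_,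
      fun j hj k hk => ?_⟩
    · rw [Finset.mem_Ioc] at hk
      rw [mem_halfEdges]
      omega
    · obtain ⟨j', hj', hj1, hj2⟩ := key j hj
      obtain ⟨k', hk', hk1, hk2⟩ := key k hk
      rw [hj2, hk2, hj1, hk1]
      have h1 := vertex_right_of_append hw (mem_halfEdges.1 hj').1
      have h2 := vertex_right_of_append hw (mem_halfEdges.1 hk').1
      simp only [weight, vertex] at h1 h2 ⊢
      omega
    · obtain ⟨j', hj', hj1, hj2⟩ := key j hj
      rw [hj2, hj1, or j' hj']
    · obtain ⟨j', hj', hj1, hj2⟩ := key j hj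
      rw [hj2, hj1, ir j' hj']
    · obtain ⟨j', hj', hj1, hj2⟩ := key j hj
      obtain ⟨k', hk', hk1, hk2⟩ := key k hk
      rw [hj2, hk2, hj1, hk1, er j' hj' k' hk']

/-- A composition is determined by the edges going from `G` to `G'`. -/
theorem ext (h : IsComp K G G') (h' : IsComp K' G G')
    (he : ∀ j ∈ G.halfEdges, ∀ k ∈ G'.halfEdges,
      ((j, k + G.weight) ∈ K.edges ↔ (j, k + G.weight) ∈ K'.edges)) : K = K' := by
  apply ext_of_vertex
  · rw [h.weight_eq, h'.weight_eq]
  · intro j hj' k hk'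
    rw [vertex, vertex, vertex, vertex, h.weights_eq, h'.weights_eq]
  · intro j hj'
    rcases h.halfEdges_cases hj' with hj | ⟨j, hj, rfl⟩
    · rw [h.outer_left hj, h'.outer_left hj]
    · rw [h.outer_right hj, h'.outer_right hj]
  · intro j hj'
    rcases h.halfEdges_cases hj' with hj | ⟨j, hj, rfl⟩
    · rw [h.inner_left hj, h'.inner_left hj]
    · rw [h.inner_right hj, h'.inner_right hj]
  · intro j hj' k hk'
    rcases h.halfEdges_cases hj' with hj | ⟨j, hj, rfl⟩ <;>
      rcases h.halfEdges_cases hk' with hk | ⟨k, hk, rfl⟩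
    · rw [h.edges_left hj hk, h'.edges_left hj hk]
    · exact he j hj k hk
    · exact iff_of_false (not_mem_edges hj hk) (not_mem_edges hj hk)
    · rw [h.edges_right hj hk, h'.edges_right hj hk]

end IsComp

section Comp

variable {G G' : BDiagram} {M : Finset (ℕ × ℕ)} (hM : M ∈ G.branchings G')

theorem mem_branchings : M ∈ G.branchings G' ↔ (∀ e ∈ M, e.1 ∈ G.freeOuter ∧ e.2 ∈ G'.freeInner) ∧
    (∀ e ∈ M, ∀ f ∈ M, e.1 = f.1 → e = f) ∧ (∀ e ∈ M, ∀ f ∈ M, e.2 = f.2 → e = f) := by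
  rw [branchings, Finset.mem_filter, Finset.mem_powerset]
  refine and_congr_left' ⟨fun h e he => Finset.mem_product.1 (h he),
    fun h e he => Finset.mem_product.2 (h e he)⟩

theorem freeOuter_subset (G : BDiagram) : G.freeOuter ⊆ G.halfEdges :=
  Finset.sdiff_subset.trans G.outer_subset

theorem freeInner_subset (G : BDiagram) : G.freeInner ⊆ G.halfEdges :=
  Finset.sdiff_subset.trans G.inner_subset

include hM in
theorem mem_halfEdges_of_mem_branching {j k : ℕ} (h : (j, k) ∈ M) :
    j ∈ G.halfEdges ∧ k ∈ G'.halfEdges :=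
  ⟨G.freeOuter_subset ((mem_branchings.1 hM).1 _ h).1,
    G'.freeInner_subset ((mem_branchings.1 hM).1 _ h).2⟩

theorem mem_comp_edges {j k : ℕ} : (j, k) ∈ (G.comp G' M hM).edges ↔
    (j, k) ∈ G.edges ∨ (∃ b, (j, b) ∈ M ∧ b + G.weight = k) ∨
      ∃ a b, (a, b) ∈ G'.edges ∧ a + G.weight = j ∧ b + G.weight = k := by
  simp only [comp, compEdges, Finset.mem_union, Finset.mem_image, Prod.exists, Prod.mk.injEq,
    or_assoc]
  constructor
  · rintro (h | ⟨a, b, h, rfl, rfl⟩ | h)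
    · exact .inl h
    · exact .inr (.inl ⟨b, h, rfl⟩)
    · exact .inr (.inr h)
  · rintro (h | ⟨b, h, rfl⟩ | h)
    · exact .inl h
    · exact .inr (.inl ⟨j, b, h, rfl, rfl⟩)
    · exact .inr (.inr h)

/-- The branching can be read off the composition, as its crossing edges. -/
theorem mem_comp_edges_cross {j k : ℕ} (hj : j ∈ G.halfEdges) (hk : k ∈ G'.halfEdges) :
    (j, k + G.weight) ∈ (G.comp G' M hM).edges ↔ (j, k) ∈ M := by
  rw [mem_comp_edges]
  rw [mem_halfEdges] at hj hk
  constructor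
  · rintro (h | ⟨b, h, hb⟩ | ⟨a, b, h, ha, hb⟩)
    · have := mem_halfEdges.1 (mem_halfEdges_of_mem_edges h).2
      omega
    · rwa [← Nat.add_right_cancel hb]
    · have := mem_halfEdges.1 (mem_halfEdges_of_mem_edges h).1
      omega
  · exact fun h => .inr (.inl ⟨k, h, rfl⟩)

theorem isComp_comp : IsComp (G.comp G' M hM) G G' := by
  apply IsComp.mk'
  · rfl
  · intro k hk
    rw [mem_halfEdges] at hk
    simp only [comp, Finset.mem_union, Finset.mem_image]
    refine or_iff_left ?_
    rintro ⟨j, hj, rfl⟩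
    have := mem_halfEdges.1 (G'.outer_subset_halfEdges hj)
    omega
  · intro k hk
    rw [mem_halfEdges] at hk
    simp only [comp, Finset.mem_union, Finset.mem_image]
    refine or_iff_left ?_
    rintro ⟨j, hj, rfl⟩
    have := mem_halfEdges.1 (G'.inner_subset_halfEdges hj)
    omega
  · intro j hj k hk
    rw [mem_comp_edges]
    rw [mem_halfEdges] at hj hk
    refine or_iff_left ?_
    rintro (⟨b, h, rfl⟩ | ⟨a, b, h, rfl, rfl⟩)
    · have := mem_halfEdges.1 (mem_halfEdges_of_mem_branching hM h).2
      omega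
    · have := mem_halfEdges.1 (mem_halfEdges_of_mem_edges h).1
      omega
  · intro k hk
    rw [mem_halfEdges] at hk
    simp only [comp, Finset.mem_union, Finset.mem_image, Nat.add_right_cancel_iff, exists_eq_right]
    refine or_iff_right fun h => ?_
    have := mem_halfEdges.1 (G.outer_subset_halfEdges h)
    omega
  · intro k hk
    rw [mem_halfEdges] at hk
    simp only [comp, Finset.mem_union, Finset.mem_image, Nat.add_right_cancel_iff, exists_eq_right]
    refine or_iff_right fun h => ?_
    have := mem_halfEdges.1 (G.inner_subset_halfEdges h)
    omega
  · intro j hj k hk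
    rw [mem_comp_edges]
    rw [mem_halfEdges] at hj hk
    constructor
    · rintro (h | ⟨b, h, hb⟩ | ⟨a, b, h, ha, hb⟩)
      · have := mem_halfEdges.1 (mem_halfEdges_of_mem_edges h).2
        omega
      · have := mem_halfEdges.1 (mem_halfEdges_of_mem_branching hM h).1
        omega
      · rwa [← Nat.add_right_cancel ha, ← Nat.add_right_cancel hb]
    · exact fun h => .inr (.inr ⟨j, k, h, rfl, rfl⟩)

end Comp

/-- Every diagram that is cut into `G` and `G'` is the composition along a branching. -/
theorem IsComp.exists_branching {K G G' : BDiagram} (h : IsComp K G G') :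
    ∃ (M : Finset (ℕ × ℕ)) (hM : M ∈ G.branchings G'), G.comp G' M hM = K := by
  -- The branching is the set of edges of `K` that cross the cut.
  have hM : (G.halfEdges ×ˢ G'.halfEdges).filter (fun e => (e.1, e.2 + G.weight) ∈ K.edges) ∈
      G.branchings G' := by
    rw [mem_branchings]
    simp only [Finset.mem_filter, Finset.mem_product]
    refine ⟨?_, ?_, ?_⟩
    · rintro ⟨j, k⟩ ⟨⟨hj, hk⟩, hjk⟩
      have hs := K.edges_spec _ hjk
      simp only at hj hk hs
      simp only [freeOuter, freeInner, Finset.mem_sdiff, Finset.mem_image, Prod.exists,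
        exists_and_right, exists_eq_right, not_exists]
      refine ⟨⟨(h.outer_left hj).1 hs.1, fun b hb => ?_⟩,
        (h.inner_right hk).1 hs.2.1, fun a ha => ?_⟩
      -- An edge of `G` at `j` would be a second edge of `K` at `j`, ending on the left of the cut
      -- whereas the crossing edge ends on its right. The inner end is treated in the same way.
      · have hb' := (mem_halfEdges_of_mem_edges hb).2
        have := K.edges_outer_unique _ hjk _ ((h.edges_left hj hb').2 hb) rfl
        rw [mem_halfEdges] at hb' hk
        simp only [Prod.mk.injEq, true_and] at this
        omega
      · have ha' := (mem_halfEdges_of_mem_edges ha).1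
        have := K.edges_inner_unique _ hjk _ ((h.edges_right ha' hk).2 ha) rfl
        rw [mem_halfEdges] at ha' hj
        simp only [Prod.mk.injEq, and_true] at this
        omega
    · rintro ⟨j, k⟩ ⟨-, hjk⟩ ⟨j', k'⟩ ⟨-, hjk'⟩ hjj
      have := K.edges_outer_unique _ hjk _ hjk' hjj
      simpa using this
    · rintro ⟨j, k⟩ ⟨-, hjk⟩ ⟨j', k'⟩ ⟨-, hjk'⟩ hkk
      have := K.edges_inner_unique _ hjk _ hjk' (congrArg (· + G.weight) hkk)
      simpa using this
  refine ⟨_, hM, (isComp_comp hM).ext h fun j hj k hk => ?_⟩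
  rw [mem_comp_edges_cross hM hj hk, Finset.mem_filter, Finset.mem_product]
  exact and_iff_right ⟨hj, hk⟩

open Classical in
/-- The compositions of `G` and `G'`. -/
noncomputable def comps (G G' : BDiagram) : Finset BDiagram :=
  (G.branchings G').attach.image fun M => G.comp G' M.1 M.2

theorem mem_comps {K G G' : BDiagram} : K ∈ G.comps G' ↔ IsComp K G G' := by
  simp only [comps, Finset.mem_image, Finset.mem_attach, true_and, Subtype.exists]
  constructor
  · rintro ⟨M, hM, rfl⟩
    exact isComp_comp hM
  · exact fun h => h.exists_branching

open Classical in
-- Different branchings have different crossing edges, hence give different compositions: the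
-- product has multiplicity one.
theorem sum_branchings {A : Type*} [AddCommMonoid A] (G G' : BDiagram) (F : BDiagram → A) :
    ∑ M ∈ (G.branchings G').attach, F (G.comp G' M.1 M.2) = ∑ K ∈ G.comps G', F K := by
  rw [comps, Finset.sum_image]
  rintro ⟨M, hM⟩ - ⟨M', hM'⟩ - h
  have key : ∀ (N N' : Finset (ℕ × ℕ)) (hN : N ∈ G.branchings G') (hN' : N' ∈ G.branchings G'),
      G.comp G' N hN = G.comp G' N' hN' → N ⊆ N' := by
    rintro N N' hN hN' h ⟨j, k⟩ hjk
    have := mem_halfEdges_of_mem_branching hN hjk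
    rwa [← mem_comp_edges_cross hN this.1 this.2, h,
      mem_comp_edges_cross hN' this.1 this.2] at hjk
  exact Subtype.ext (subset_antisymm (key M M' hM hM' h) (key M' M hM' hM h.symm))

/-! ### Associativity of the product. -/

/-- `L` is cut into `G`, `G'` and `G''`. -/
structure IsComp₃ (L G G' G'' : BDiagram) : Prop where
  weights_eq : L.weights = G.weights ++ G'.weights ++ G''.weights
  left : IsPart L (Finset.Ioc 0 G.weight) G
  middle : IsPart L (Finset.Ioc G.weight (G.weight + G'.weight)) G'
  right : IsPart L (Finset.Ioc (G.weight + G'.weight)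
    (G.weight + G'.weight + G''.weight)) G''

/-- The intermediate composition carries no information: it is forced to be the restriction of `L`
to its first two blocks. -/
theorem isComp₃_iff_left {K L G G' G'' : BDiagram} :
    (IsComp K G G' ∧ IsComp L K G'') ↔
      IsComp₃ L G G' G'' ∧ K = L.part (Finset.Ioc 0 (G.weight + G'.weight)) := by
  have hsum : (G.weights ++ G'.weights).sum = G.weight + G'.weight := by simp [weight]
  constructor
  · rintro ⟨hK, hL⟩
    have hw : L.weights = G.weights ++ G'.weights ++ G''.weights := by
      rw [hL.weights_eq, hK.weights_eq]
    have hl := hL.left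
    have hr := hL.right
    rw [hK.weight_eq] at hl hr
    refine ⟨⟨hw, ?_, ?_, hr⟩, ?_⟩
    · have := (hl.isPart_Ioc_iff (by omega)).1 hK.left
      rwa [Nat.zero_add, Nat.zero_add] at this
    · have := (hl.isPart_Ioc_iff (by omega)).1 hK.right
      rwa [Nat.zero_add, Nat.zero_add] at this
    · have := isSaturated_left_of_append hw
      rw [hsum] at this
      exact (part_eq this hl).symm
  · rintro ⟨hL, rfl⟩
    have hs := isSaturated_left_of_append hL.weights_eq
    rw [hsum] at hs
    have hp := isPart_part hs
    have hw := weights_left_of_append hL.weights_eq (by rwa [hsum])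
    have hww : (L.part (Finset.Ioc 0 (G.weight + G'.weight))).weight = G.weight + G'.weight := by
      rw [weight, hw, hsum]
    refine ⟨⟨hw, ?_, ?_⟩, ⟨by rw [hw, hL.weights_eq], by rwa [hww], by rw [hww]; exact hL.right⟩⟩
    · rw [hp.isPart_Ioc_iff (by omega), Nat.zero_add, Nat.zero_add]
      exact hL.left
    · rw [hp.isPart_Ioc_iff (by omega), Nat.zero_add, Nat.zero_add]
      exact hL.middle

theorem isComp₃_iff_right {K L G G' G'' : BDiagram} :
    (IsComp K G' G'' ∧ IsComp L G K) ↔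
      IsComp₃ L G G' G'' ∧
        K = L.part (Finset.Ioc G.weight (G.weight + (G'.weight + G''.weight))) := by
  have hsum : (G'.weights ++ G''.weights).sum = G'.weight + G''.weight := by simp [weight]
  constructor
  · rintro ⟨hK, hL⟩
    have hw : L.weights = G.weights ++ (G'.weights ++ G''.weights) := by
      rw [hL.weights_eq, hK.weights_eq]
    have hr := hL.right
    rw [hK.weight_eq] at hr
    refine ⟨⟨by rw [hw, List.append_assoc], hL.left, ?_, ?_⟩, ?_⟩
    · exact (hr.isPart_Ioc_iff (p := 0) (by omega)).1 hK.left
    · have := (hr.isPart_Ioc_iff (by omega)).1 hK.right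
      rwa [← Nat.add_assoc] at this
    · have := isSaturated_right_of_append hw
      rw [hsum] at this
      exact (part_eq this hr).symm
  · rintro ⟨hL, rfl⟩
    have hLw := hL.weights_eq
    rw [List.append_assoc] at hLw
    have hs := isSaturated_right_of_append hLw
    rw [hsum] at hs
    change L.IsSaturated (Finset.Ioc G.weight (G.weight + (G'.weight + G''.weight))) at hs
    have hp := isPart_part hs
    have hw := weights_right_of_append hLw (by rw [hsum]; exact hp)
    have hww : (L.part (Finset.Ioc G.weight (G.weight + (G'.weight + G''.weight)))).weight =
        G'.weight + G''.weight := by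
      rw [weight, hw, hsum]
    refine ⟨⟨hw, ?_, ?_⟩, ⟨by rw [hw, hLw], hL.left, by rwa [hww]⟩⟩
    · rw [hp.isPart_Ioc_iff (by omega)]
      exact hL.middle
    · rw [hp.isPart_Ioc_iff (by omega), ← Nat.add_assoc]
      exact hL.right

/-- On both sides the outcome `L` runs over the diagrams cut into `G`, `G'`, `G''`, and `K` is a
function of `L`. -/
theorem sum_comps_assoc {A : Type*} [AddCommMonoid A] (G G' G'' : BDiagram) (F : BDiagram → A) :
    ∑ K ∈ G.comps G', ∑ L ∈ K.comps G'', F L = ∑ K ∈ G'.comps G'', ∑ L ∈ G.comps K, F L := by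
  rw [Finset.sum_sigma', Finset.sum_sigma']
  refine Finset.sum_bij'
    (fun p _ => ⟨p.2.part (Finset.Ioc G.weight (G.weight + (G'.weight + G''.weight))), p.2⟩)
    (fun p _ => ⟨p.2.part (Finset.Ioc 0 (G.weight + G'.weight)), p.2⟩) ?_ ?_ ?_ ?_ ?_
  · rintro ⟨K, L⟩ h
    simp only [Finset.mem_sigma, mem_comps] at h ⊢
    rw [isComp₃_iff_left] at h
    exact isComp₃_iff_right.2 ⟨h.1, rfl⟩
  · rintro ⟨K, L⟩ h
    simp only [Finset.mem_sigma, mem_comps] at h ⊢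
    rw [isComp₃_iff_right] at h
    exact isComp₃_iff_left.2 ⟨h.1, rfl⟩
  · rintro ⟨K, L⟩ h
    simp only [Finset.mem_sigma, mem_comps] at h
    rw [isComp₃_iff_left] at h
    simp [h.2]
  · rintro ⟨K, L⟩ h
    simp only [Finset.mem_sigma, mem_comps] at h
    rw [isComp₃_iff_right] at h
    simp [h.2]
  · intros
    rfl

end BDiagram

/-! ### Compatibility of the product with the coproduct. -/

/-- The trace of `S` on `U`, relabelled with `U`. -/
def restrictTo (U S : Finset ℕ) : Finset ℕ := (S ∩ U).image (relabel U)

theorem card_restrictTo (U S : Finset ℕ) : (restrictTo U S).card = (S ∩ U).card :=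
  card_image_relabel Finset.inter_subset_right

theorem restrictTo_sdiff {U S W : Finset ℕ} (hU : U ⊆ W) :
    restrictTo U (W \ S) = Finset.Icc 1 U.card \ restrictTo U S := by
  have h : (W \ S) ∩ U = U \ (S ∩ U) := by
    ext k
    simp only [Finset.mem_inter, Finset.mem_sdiff]
    have := @hU k
    tauto
  rw [restrictTo, h, Finset.image_sdiff_of_injOn _ Finset.inter_subset_right, image_relabel,
    restrictTo]
  exact fun i hi j hj => relabel_injOn U hi hj

theorem Icc_one_eq_Ioc (n : ℕ) : Finset.Icc 1 n = Finset.Ioc 0 n := by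
  ext k
  simp only [Finset.mem_Icc, Finset.mem_Ioc]
  omega

section Split

variable {S : Finset ℕ} {a b : ℕ}

theorem card_split (hS : S ⊆ Finset.Ioc 0 (a + b)) :
    S.card = (S ∩ Finset.Ioc 0 a).card + (S ∩ Finset.Ioc a (a + b)).card := by
  rw [← Finset.card_union_of_disjoint, ← Finset.inter_union_distrib_left,
    Finset.Ioc_union_Ioc_eq_Ioc (by omega) (by omega), Finset.inter_eq_left.2 hS]
  rw [Finset.disjoint_left]
  intro k hk hk'
  simp only [Finset.mem_inter, Finset.mem_Ioc] at hk hk'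
  omega

/-- The elements of `S` up to `a` precede all its other elements, so their ranks fill an initial
interval. This locates the cut of a composition after restriction to `S`. -/
theorem restrictTo_left (hS : S ⊆ Finset.Ioc 0 (a + b)) :
    restrictTo S (Finset.Ioc 0 a) = Finset.Ioc 0 (S ∩ Finset.Ioc 0 a).card := by
  rw [restrictTo, Finset.inter_comm, ← Icc_one_eq_Ioc (Finset.card _), ← image_relabel]
  refine Finset.image_congr fun k hk => relabel_congr fun j hj => ?_
  simp only [Finset.coe_inter, Set.mem_inter_iff, Finset.mem_coe, Finset.mem_Ioc] at hk
  rw [Finset.mem_inter, Finset.mem_Ioc]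
  refine ⟨fun h => ⟨h, ?_⟩, fun h => h.1⟩
  have := Finset.mem_Ioc.1 (hS h)
  omega

theorem restrictTo_right (hS : S ⊆ Finset.Ioc 0 (a + b)) :
    restrictTo S (Finset.Ioc a (a + b)) =
      Finset.Ioc (S ∩ Finset.Ioc 0 a).card
        ((S ∩ Finset.Ioc 0 a).card + (S ∩ Finset.Ioc a (a + b)).card) := by
  have h : Finset.Ioc a (a + b) = Finset.Ioc 0 (a + b) \ Finset.Ioc 0 a := by
    ext k
    simp only [Finset.mem_sdiff, Finset.mem_Ioc]
    omega
  rw [h, restrictTo_sdiff hS, restrictTo_left hS, ← h, card_split hS]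
  ext k
  simp only [Finset.mem_sdiff, Finset.mem_Ioc, Finset.mem_Icc]
  omega

end Split

namespace BDiagram

section IsPart

variable {K H L : BDiagram} {U S : Finset ℕ}

/-- As the intersection is symmetric, this allows restrictions to `U` and to `S` to be exchanged. -/
theorem IsPart.isPart_restrictTo_iff (h : IsPart K U H) :
    IsPart H (restrictTo U S) L ↔ IsPart K (S ∩ U) L :=
  h.isPart_iff Finset.inter_subset_right

theorem IsPart.restrictTo_compl (h : IsPart K U H) :
    restrictTo U (K.halfEdges \ S) = H.halfEdges \ restrictTo U S := by
  rw [restrictTo_sdiff h.subset, halfEdges, h.weight_eq]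

theorem IsPart.restrictTo_mem_closedSets (h : IsPart K U H) (hS : S ∈ K.closedSets) :
    restrictTo U S ∈ H.closedSets := by
  rw [mem_closedSets] at *
  refine ⟨?_, fun j hj k hk hjk => ?_⟩
  · rw [← h.image_eq]
    exact Finset.image_subset_image Finset.inter_subset_right
  · obtain ⟨j, hjU, rfl⟩ := h.exists_eq hj
    obtain ⟨k, hkU, rfl⟩ := h.exists_eq hk
    rw [h.vertex_iff j hjU k hkU, h.edges_iff j hjU k hkU] at hjk
    have := hS.2 j (h.subset hjU) k (h.subset hkU) hjk
    rw [restrictTo, mem_image_relabel Finset.inter_subset_right hjU,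
      mem_image_relabel Finset.inter_subset_right hkU, Finset.mem_inter, Finset.mem_inter]
    tauto

end IsPart

/-- A diagram cut into `G` and `G'` at a vertex boundary is a composition of `G` and `G'`. -/
theorem IsComp.of_isPart {K G G' : BDiagram} (hw : K.weight = G.weight + G'.weight)
    (hl : IsPart K (Finset.Ioc 0 G.weight) G)
    (hr : IsPart K (Finset.Ioc G.weight (G.weight + G'.weight)) G')
    (hv : ∀ j ∈ Finset.Ioc 0 G.weight, ∀ k ∈ Finset.Ioc G.weight (G.weight + G'.weight),
      K.vertex j ≠ K.vertex k) : IsComp K G G' := by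
  refine ⟨?_, hl, hr⟩
  have hleft : ∀ j ∈ Finset.Ioc 0 G.weight,
      vertexOf (G.weights ++ G'.weights) j = G.vertex (relabel (Finset.Ioc 0 G.weight) j) := by
    intro j hj
    rw [Finset.mem_Ioc] at hj
    rw [relabel_Ioc hj.2, Nat.sub_zero, vertex, vertexOf_append_left _ _ _ hj.1 hj.2]
  have hright : ∀ j ∈ Finset.Ioc G.weight (G.weight + G'.weight),
      vertexOf (G.weights ++ G'.weights) j =
        G'.vertex (relabel (Finset.Ioc G.weight (G.weight + G'.weight)) j) + G.numVertices := by
    intro j hj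
    rw [Finset.mem_Ioc] at hj
    have := vertexOf_append_right G.weights G'.weights (j - G.weight) (by omega)
    rw [← weight, Nat.sub_add_cancel hj.1.le] at this
    rw [relabel_Ioc hj.2, this, vertex, numVertices]
  have hcross : ∀ j ∈ Finset.Ioc 0 G.weight, ∀ k ∈ Finset.Ioc G.weight (G.weight + G'.weight),
      vertexOf (G.weights ++ G'.weights) j ≠ vertexOf (G.weights ++ G'.weights) k := by
    intro j hj k hk
    rw [hleft j hj, hright k hk]
    have h1 := Finset.mem_Icc.1 (vertex_mem_vertices (hl.relabel_mem hj))
    have h2 := Finset.mem_Icc.1 (vertex_mem_vertices (hr.relabel_mem hk))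
    omega
  refine weights_ext K.weights_pos ?_ (by rw [List.sum_append]; exact hw) ?_
  · intro p hp
    rcases List.mem_append.1 hp with h | h
    · exact G.weights_pos p h
    · exact G'.weights_pos p h
  · have cases : ∀ j ∈ Finset.Icc 1 K.weight,
        j ∈ Finset.Ioc 0 G.weight ∨ j ∈ Finset.Ioc G.weight (G.weight + G'.weight) := by
      intro j hj
      simp only [Finset.mem_Icc, Finset.mem_Ioc] at *
      omega
    intro j hj k hk
    rcases cases j hj with hj | hj <;> rcases cases k hk with hk | hk
    · rw [hleft j hj, hleft k hk, hl.vertex_iff j hj k hk, vertex, vertex]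
    · exact iff_of_false (hv j hj k hk) (hcross j hj k hk)
    · exact iff_of_false (hv k hk j hj).symm (hcross k hk j hj).symm
    · rw [hright j hj, hright k hk, Nat.add_right_cancel_iff, hr.vertex_iff j hj k hk, vertex,
        vertex]

theorem subset_Ioc_of_mem_closedSets {K : BDiagram} {S : Finset ℕ} {n : ℕ}
    (hS : S ∈ K.closedSets) (hn : K.weight = n) : S ⊆ Finset.Ioc 0 n := by
  have := (mem_closedSets.1 hS).1
  rwa [halfEdges, hn, Icc_one_eq_Ioc] at this

/-- Restricting a composition of `G` and `G'` to a closed set gives a composition of restrictions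
of `G` and `G'`. -/
theorem IsComp.part {K G G' : BDiagram} {S : Finset ℕ} (h : IsComp K G G')
    (hS : S ∈ K.closedSets) :
    IsComp (K.part S) (G.part (restrictTo (Finset.Ioc 0 G.weight) S))
      (G'.part (restrictTo (Finset.Ioc G.weight (G.weight + G'.weight)) S)) := by
  have hsub := subset_Ioc_of_mem_closedSets hS h.weight_eq
  have hP := isPart_of_mem hS
  have hl := isPart_of_mem (h.left.restrictTo_mem_closedSets hS)
  have hr := isPart_of_mem (h.right.restrictTo_mem_closedSets hS)
  have hlw := hl.weight_eq
  have hrw := hr.weight_eq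
  rw [card_restrictTo] at hlw hrw
  apply IsComp.of_isPart
  · rw [hP.weight_eq, hlw, hrw, card_split hsub]
  -- The left block of the restriction of `K` and the restriction of the left block of `K` are both
  -- the restriction of `K` to `S ∩ Finset.Ioc 0 G.weight`.
  · rw [hlw, ← restrictTo_left hsub, hP.isPart_restrictTo_iff, Finset.inter_comm,
      ← h.left.isPart_restrictTo_iff]
    exact hl
  · rw [hlw, hrw, ← restrictTo_right hsub, hP.isPart_restrictTo_iff, Finset.inter_comm,
      ← h.right.isPart_restrictTo_iff]
    exact hr
  · intro j hj k hk
    rw [hlw, ← restrictTo_left hsub] at hj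
    rw [hlw, hrw, ← restrictTo_right hsub] at hk
    obtain ⟨j, hj', rfl⟩ := Finset.mem_image.1 hj
    obtain ⟨k, hk', rfl⟩ := Finset.mem_image.1 hk
    rw [Finset.mem_inter, Finset.mem_Ioc] at hj' hk'
    rw [Ne, hP.vertex_iff j hj'.2 k hk'.2]
    exact (vertex_lt_of_append h.weights_eq hj'.1.1 hj'.1.2 hk'.1.1).ne

/-- A diagram is determined by its weights and its restrictions to two complementary closed
sets. -/
theorem eq_of_isPart {K K' A B : BDiagram} {S : Finset ℕ} (hw : K.weights = K'.weights)
    (hS : S ∈ K.closedSets) (hS' : S ∈ K'.closedSets) (hA : IsPart K S A) (hA' : IsPart K' S A)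
    (hB : IsPart K (K.halfEdges \ S) B) (hB' : IsPart K' (K'.halfEdges \ S) B) : K = K' := by
  have hww : K.weight = K'.weight := by rw [weight, weight, hw]
  have hh : K'.halfEdges = K.halfEdges := by rw [halfEdges, halfEdges, hww]
  rw [hh] at hB'
  have hc : ∀ k ∈ K.halfEdges, k ∉ S → k ∈ K.halfEdges \ S :=
    fun k hk hkS => Finset.mem_sdiff.2 ⟨hk, hkS⟩
  apply ext_of_vertex hww
  · intro j _ k _
    rw [vertex, vertex, vertex, vertex, hw]
  · intro j hj
    by_cases hjS : j ∈ S
    · rw [← hA.outer_iff j hjS, hA'.outer_iff j hjS]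
    · rw [← hB.outer_iff j (hc j hj hjS), hB'.outer_iff j (hc j hj hjS)]
  · intro j hj
    by_cases hjS : j ∈ S
    · rw [← hA.inner_iff j hjS, hA'.inner_iff j hjS]
    · rw [← hB.inner_iff j (hc j hj hjS), hB'.inner_iff j (hc j hj hjS)]
  · intro j hj k hk
    by_cases hjk : j ∈ S ↔ k ∈ S
    · by_cases hjS : j ∈ S
      · have hkS := hjk.1 hjS
        rw [← hA.edges_iff j hjS k hkS, hA'.edges_iff j hjS k hkS]
      · have hkS := fun h => hjS (hjk.2 h)
        rw [← hB.edges_iff j (hc j hj hjS) k (hc k hk hkS),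
          hB'.edges_iff j (hc j hj hjS) k (hc k hk hkS)]
    -- No edge joins `S` to its complement, in either diagram.
    · refine iff_of_false (fun h => hjk ?_) (fun h => hjk ?_)
      · exact (mem_closedSets.1 hS).2 j hj k hk (.inr h)
      · exact (mem_closedSets.1 hS').2 j (hh ▸ hj) k (hh ▸ hk) (.inr h)

theorem IsPart.of_weights {K A B : BDiagram} {S : Finset ℕ} (h : IsPart K S A)
    (hw : B.weights = A.weights) : B.weight = S.card ∧ ∀ j ∈ S, ∀ k ∈ S,
      (B.vertex (relabel S j) = B.vertex (relabel S k) ↔ K.vertex j = K.vertex k) := by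
  refine ⟨by rw [← h.weight_eq, weight, weight, hw], fun j hj k hk => ?_⟩
  rw [← h.vertex_iff j hj k hk, vertex, vertex, vertex, vertex, hw]

/-- The restrictions of a diagram to two complementary closed sets may be replaced by any diagrams
with the same weights. -/
theorem exists_glue {K₀ A B : BDiagram} {S : Finset ℕ} (hS : S ∈ K₀.closedSets)
    (hA : A.weights = (K₀.part S).weights)
    (hB : B.weights = (K₀.part (K₀.halfEdges \ S)).weights) :
    ∃ K : BDiagram, K.weights = K₀.weights ∧ S ∈ K.closedSets ∧ IsPart K S A ∧
      IsPart K (K.halfEdges \ S) B := by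
  obtain ⟨hAw, hAv⟩ := (isPart_of_mem hS).of_weights hA
  obtain ⟨hBw, hBv⟩ := (isPart_of_mem (compl_mem_closedSets hS)).of_weights hB
  have hSW := (mem_closedSets.1 hS).1
  have hSv := (isSaturated_of_mem hS).mem_iff
  set W := K₀.halfEdges with hW
  set C := W \ S with hC
  -- `D` and `K₀` are compared only through the relation "same vertex". The order of the vertices
  -- follows: an edge of `D` increases labels, `relabel T` reflects their order, and vertices of
  -- `K₀` are monotone in the label.
  have hlt : ∀ (D : BDiagram) (T : Finset ℕ),
      (∀ j ∈ T, ∀ k ∈ T,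
        (D.vertex (relabel T j) = D.vertex (relabel T k) ↔ K₀.vertex j = K₀.vertex k)) →
      ∀ j ∈ T, ∀ k ∈ T, (relabel T j, relabel T k) ∈ D.edges → K₀.vertex j < K₀.vertex k := by
    intro D T hD j hj k hk h
    have h1 := (D.edges_spec _ h).2.2
    have h2 : j < k := by
      have := lt_of_mem_edges h
      by_contra hkj
      have := (relabel_le_iff T hk hj).2 (not_lt.1 hkj)
      omega
    refine lt_of_le_of_ne (K₀.vertex_mono h2.le) fun h3 => ?_
    exact h1.ne ((hD j hj k hk).2 h3)
  have hmemC : ∀ k, k ∈ C ↔ k ∈ W ∧ k ∉ S := fun k => Finset.mem_sdiff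
  -- `K` keeps the vertices of `K₀` and carries `A` on `S` and `B` on `C`, with no mixed edge. Two
  -- edges sharing an end lie on the same side, so uniqueness is inherited from `A` or from `B`.
  let K : BDiagram :=
    { weights := K₀.weights
      weights_pos := K₀.weights_pos
      outer := W.filter fun k => (k ∈ S ∧ relabel S k ∈ A.outer) ∨ (k ∈ C ∧ relabel C k ∈ B.outer)
      inner := W.filter fun k => (k ∈ S ∧ relabel S k ∈ A.inner) ∨ (k ∈ C ∧ relabel C k ∈ B.inner)
      edges := (W ×ˢ W).filter fun e =>
        (e.1 ∈ S ∧ e.2 ∈ S ∧ (relabel S e.1, relabel S e.2) ∈ A.edges) ∨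
          (e.1 ∈ C ∧ e.2 ∈ C ∧ (relabel C e.1, relabel C e.2) ∈ B.edges)
      outer_subset := Finset.filter_subset _ _
      inner_subset := Finset.filter_subset _ _
      edges_spec := by
        rintro ⟨j, k⟩ h
        simp only [Finset.mem_filter, Finset.mem_product] at h ⊢
        obtain ⟨⟨hj, hk⟩, ⟨h1, h2, h3⟩ | ⟨h1, h2, h3⟩⟩ := h
        · have := A.edges_spec _ h3
          exact ⟨⟨hj, .inl ⟨h1, this.1⟩⟩, ⟨hk, .inl ⟨h2, this.2.1⟩⟩, hlt A S hAv j h1 k h2 h3⟩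
        · have := B.edges_spec _ h3
          exact ⟨⟨hj, .inr ⟨h1, this.1⟩⟩, ⟨hk, .inr ⟨h2, this.2.1⟩⟩, hlt B C hBv j h1 k h2 h3⟩
      edges_outer_unique := by
        rintro ⟨j, k⟩ h ⟨j', k'⟩ h' (rfl : j = j')
        simp only [Finset.mem_filter, hmemC] at h h'
        obtain ⟨-, ⟨h1, h2, h3⟩ | ⟨h1, h2, h3⟩⟩ := h <;>
          obtain ⟨-, ⟨h1', h2', h3'⟩ | ⟨h1', h2', h3'⟩⟩ := h'
        · have := A.edges_outer_unique _ h3 _ h3' rfl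
          rw [relabel_injOn S h2 h2' (congrArg Prod.snd this)]
        · exact absurd h1 h1'.2
        · exact absurd h1' h1.2
        · have := B.edges_outer_unique _ h3 _ h3' rfl
          rw [relabel_injOn C ((hmemC k).2 h2) ((hmemC k').2 h2') (congrArg Prod.snd this)]
      edges_inner_unique := by
        rintro ⟨j, k⟩ h ⟨j', k'⟩ h' (rfl : k = k')
        simp only [Finset.mem_filter, hmemC] at h h'
        obtain ⟨-, ⟨h1, h2, h3⟩ | ⟨h1, h2, h3⟩⟩ := h <;>
          obtain ⟨-, ⟨h1', h2', h3'⟩ | ⟨h1', h2', h3'⟩⟩ := h'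
        · have := A.edges_inner_unique _ h3 _ h3' rfl
          rw [relabel_injOn S h1 h1' (congrArg Prod.fst this)]
        · exact absurd h2 h2'.2
        · exact absurd h2' h2.2
        · have := B.edges_inner_unique _ h3 _ h3' rfl
          rw [relabel_injOn C ((hmemC j).2 h1) ((hmemC j').2 h1') (congrArg Prod.fst this)] }
  have hKW : K.halfEdges = W := rfl
  have hCW : C ⊆ W := Finset.sdiff_subset
  have hSC : ∀ k ∈ S, k ∉ C := fun k hk hkC => ((hmemC k).1 hkC).2 hk
  have hCS : ∀ k ∈ C, k ∉ S := fun k hk => ((hmemC k).1 hk).2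
  refine ⟨K, rfl, ?_, ⟨hSW, hAw, hAv, ?_, ?_, ?_⟩, ⟨hCW, hBw, hBv, ?_, ?_, ?_⟩⟩
  · rw [mem_closedSets]
    refine ⟨hSW, ?_⟩
    rintro j hj k hk (h | h)
    · exact hSv j hj k hk h
    · simp only [K, Finset.mem_filter] at h
      obtain ⟨-, ⟨h1, h2, h3⟩ | ⟨h1, h2, h3⟩⟩ := h
      · exact iff_of_true h1 h2
      · exact iff_of_false (hCS j h1) (hCS k h2)
  · intro j hj
    simp only [K, Finset.mem_filter]
    have := hSW hj
    have := hSC j hj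
    tauto
  · intro j hj
    simp only [K, Finset.mem_filter]
    have := hSW hj
    have := hSC j hj
    tauto
  · intro j hj k hk
    simp only [K, Finset.mem_filter, Finset.mem_product]
    have := hSW hj
    have := hSC j hj
    have := hSW hk
    tauto
  · intro j hj
    change j ∈ C at hj
    change relabel C j ∈ B.outer ↔ _
    simp only [K, Finset.mem_filter]
    have := hCW hj
    have := hCS j hj
    tauto
  · intro j hj
    change j ∈ C at hj
    change relabel C j ∈ B.inner ↔ _
    simp only [K, Finset.mem_filter]
    have := hCW hj
    have := hCS j hj
    tauto
  · intro j hj k hk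
    change j ∈ C at hj
    change k ∈ C at hk
    change (relabel C j, relabel C k) ∈ B.edges ↔ _
    simp only [K, Finset.mem_filter, Finset.mem_product]
    have := hCW hj
    have := hCS j hj
    have := hCW hk
    tauto

theorem empty_mem_branchings (G G' : BDiagram) : ∅ ∈ G.branchings G' := by
  simp [mem_branchings]

/-- The union of a set of half-edges of `G` and a set of half-edges of `G'`, as a set of
half-edges of a composition of `G` and `G'`, where `a` is the weight of `G`. -/
def joinSets (a : ℕ) (S S' : Finset ℕ) : Finset ℕ := S ∪ S'.image (· + a)

theorem mem_joinSets {a : ℕ} {S S' : Finset ℕ} {k : ℕ} :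
    k ∈ joinSets a S S' ↔ k ∈ S ∨ ∃ j ∈ S', j + a = k := by
  simp [joinSets]

theorem restrictTo_left_joinSets {a b : ℕ} {S S' : Finset ℕ} (hS : S ⊆ Finset.Icc 1 a)
    (hS' : S' ⊆ Finset.Icc 1 b) : restrictTo (Finset.Ioc 0 a) (joinSets a S S') = S := by
  have h : joinSets a S S' ∩ Finset.Ioc 0 a = S := by
    ext k
    rw [Finset.mem_inter, mem_joinSets, Finset.mem_Ioc]
    constructor
    · rintro ⟨h | ⟨j, hj, rfl⟩, h2⟩
      · exact h
      · have := Finset.mem_Icc.1 (hS' hj)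
        omega
    · intro hk
      have := Finset.mem_Icc.1 (hS hk)
      exact ⟨.inl hk, by omega⟩
  rw [restrictTo, h]
  conv_rhs => rw [← Finset.image_id (s := S)]
  refine Finset.image_congr fun k hk => ?_
  have := Finset.mem_Icc.1 (hS hk)
  rw [relabel_Ioc this.2, Nat.sub_zero, id]

theorem restrictTo_right_joinSets {a b : ℕ} {S S' : Finset ℕ} (hS : S ⊆ Finset.Icc 1 a)
    (hS' : S' ⊆ Finset.Icc 1 b) :
    restrictTo (Finset.Ioc a (a + b)) (joinSets a S S') = S' := by
  ext k
  simp only [restrictTo, Finset.mem_image, Finset.mem_inter, mem_joinSets, Finset.mem_Ioc]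
  constructor
  · rintro ⟨_, ⟨h | ⟨j, hj, rfl⟩, h2⟩, rfl⟩
    · have := Finset.mem_Icc.1 (hS h)
      omega
    · rwa [relabel_Ioc h2.2, Nat.add_sub_cancel]
  · intro hk
    have := Finset.mem_Icc.1 (hS' hk)
    exact ⟨k + a, ⟨.inr ⟨k, hk, rfl⟩, by omega⟩, by rw [relabel_Ioc (by omega)]; omega⟩

theorem joinSets_restrictTo {a b : ℕ} {S : Finset ℕ} (hS : S ⊆ Finset.Ioc 0 (a + b)) :
    joinSets a (restrictTo (Finset.Ioc 0 a) S) (restrictTo (Finset.Ioc a (a + b)) S) = S := by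
  ext k
  simp only [mem_joinSets, restrictTo, Finset.mem_image, Finset.mem_inter, Finset.mem_Ioc]
  constructor
  · rintro (⟨j, ⟨hj, h⟩, rfl⟩ | ⟨_, ⟨j, ⟨hj, h⟩, rfl⟩, rfl⟩)
    · rwa [relabel_Ioc h.2, Nat.sub_zero]
    · rwa [relabel_Ioc h.2, Nat.sub_add_cancel h.1.le]
  · intro hk
    have := Finset.mem_Ioc.1 (hS hk)
    by_cases hka : k ≤ a
    · exact .inl ⟨k, ⟨hk, by omega⟩, by rw [relabel_Ioc hka, Nat.sub_zero]⟩
    · refine .inr ⟨_, ⟨k, ⟨hk, by omega⟩, rfl⟩, ?_⟩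
      rw [relabel_Ioc this.2, Nat.sub_add_cancel (by omega)]

/-- Composition along the empty branching is the disjoint union, without crossing edges, so any two
closed sets join to a closed set. For other branchings a crossing edge could leave the union. -/
theorem joinSets_mem_closedSets {G G' : BDiagram} {S S' : Finset ℕ} (hS : S ∈ G.closedSets)
    (hS' : S' ∈ G'.closedSets) :
    joinSets G.weight S S' ∈ (G.comp G' ∅ (empty_mem_branchings G G')).closedSets := by
  have h := isComp_comp (empty_mem_branchings G G')
  rw [mem_closedSets] at *
  have hl : ∀ k ∈ G.halfEdges, (k ∈ joinSets G.weight S S' ↔ k ∈ S) := by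
    intro k hk
    rw [mem_joinSets]
    refine or_iff_left ?_
    rintro ⟨j, hj, rfl⟩
    have := mem_halfEdges.1 (hS'.1 hj)
    have := mem_halfEdges.1 hk
    omega
  have hr : ∀ k ∈ G'.halfEdges, (k + G.weight ∈ joinSets G.weight S S' ↔ k ∈ S') := by
    intro k hk
    simp only [mem_joinSets, Nat.add_right_cancel_iff, exists_eq_right]
    refine or_iff_right fun h => ?_
    have := mem_halfEdges.1 (hS.1 h)
    have := mem_halfEdges.1 hk
    omega
  constructor
  · intro k hk
    rcases mem_joinSets.1 hk with hk | ⟨j, hj, rfl⟩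
    · exact h.left_mem (hS.1 hk)
    · exact h.right_mem (hS'.1 hj)
  intro j hj' k hk' hjk
  rcases h.halfEdges_cases hj' with hj | ⟨j, hj, rfl⟩ <;>
    rcases h.halfEdges_cases hk' with hk | ⟨k, hk, rfl⟩
  · rw [hl j hj, hl k hk]
    rw [h.vertex_left hj, h.vertex_left hk, h.edges_left hj hk] at hjk
    exact hS.2 j hj k hk hjk
  · rcases hjk with hjk | hjk
    · exact absurd hjk (h.vertex_lt hj hk).ne
    · rw [mem_comp_edges_cross _ hj hk] at hjk
      simp at hjk
  · rcases hjk with hjk | hjk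
    · exact absurd hjk (h.vertex_lt hk hj).ne'
    · exact absurd hjk (IsComp.not_mem_edges hj hk)
  · rw [hr j hj, hr k hk]
    rw [h.vertex_right hj, h.vertex_right hk, h.edges_right hj hk, Nat.add_right_cancel_iff] at hjk
    exact hS'.2 j hj k hk hjk

/-- A set of labels is recovered from its traces on the two blocks, and traces commute with
complements. -/
theorem halfEdges_sdiff_joinSets {G G' : BDiagram} {S S' : Finset ℕ} (hS : S ⊆ G.halfEdges)
    (hS' : S' ⊆ G'.halfEdges) :
    Finset.Icc 1 (G.weight + G'.weight) \ joinSets G.weight S S' =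
      joinSets G.weight (G.halfEdges \ S) (G'.halfEdges \ S') := by
  rw [Icc_one_eq_Ioc]
  conv_lhs => rw [← joinSets_restrictTo (a := G.weight) (b := G'.weight)
    (S := Finset.Ioc 0 (G.weight + G'.weight) \ joinSets G.weight S S') Finset.sdiff_subset]
  rw [restrictTo_sdiff (Finset.Ioc_subset_Ioc_right (by omega)),
    restrictTo_sdiff (Finset.Ioc_subset_Ioc_left (by omega)), restrictTo_left_joinSets hS hS',
    restrictTo_right_joinSets hS hS', Nat.card_Ioc, Nat.card_Ioc, Nat.sub_zero,
    Nat.add_sub_cancel_left, halfEdges, halfEdges]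

/-- The disjoint union of `G` and `G'` serves as a scaffold: its restrictions to the joined set and
to the complement have the weights of `A` and `B`, so `exists_glue` puts `A` and `B` in their place.
It remains to see that the blocks of the glued diagram are `G` and `G'`. -/
theorem exists_isComp_of_parts {G G' A B : BDiagram} {S S' : Finset ℕ} (hS : S ∈ G.closedSets)
    (hS' : S' ∈ G'.closedSets) (hA : IsComp A (G.part S) (G'.part S'))
    (hB : IsComp B (G.part (G.halfEdges \ S)) (G'.part (G'.halfEdges \ S'))) :
    ∃ K : BDiagram, IsComp K G G' ∧ joinSets G.weight S S' ∈ K.closedSets ∧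
      IsPart K (joinSets G.weight S S') A ∧
      IsPart K (K.halfEdges \ joinSets G.weight S S') B := by
  have hsub := (mem_closedSets.1 hS).1
  have hsub' := (mem_closedSets.1 hS').1
  have h₀ := isComp_comp (empty_mem_branchings G G')
  have hj := joinSets_mem_closedSets hS hS'
  have hc := joinSets_mem_closedSets (compl_mem_closedSets hS) (compl_mem_closedSets hS')
  have hJl := restrictTo_left_joinSets hsub hsub'
  have hJr := restrictTo_right_joinSets hsub hsub'
  have hCl := restrictTo_left_joinSets (Finset.sdiff_subset (s := G.halfEdges) (t := S))
    (Finset.sdiff_subset (s := G'.halfEdges) (t := S'))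
  have hCr := restrictTo_right_joinSets (Finset.sdiff_subset (s := G.halfEdges) (t := S))
    (Finset.sdiff_subset (s := G'.halfEdges) (t := S'))
  have hJsub := subset_Ioc_of_mem_closedSets hj h₀.weight_eq
  have hCsub := subset_Ioc_of_mem_closedSets hc h₀.weight_eq
  have hcompl := halfEdges_sdiff_joinSets hsub hsub'
  obtain ⟨K, hKw, hKS, hKA, hKB⟩ := exists_glue (A := A) (B := B) hj
    (by
      have := h₀.part hj
      rw [hJl, hJr] at this
      rw [hA.weights_eq, this.weights_eq])
    (by
      have := h₀.part hc
      rw [hCl, hCr] at this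
      rw [halfEdges, h₀.weight_eq, hcompl, hB.weights_eq, this.weights_eq])
  refine ⟨K, ?_, hKS, hKA, hKB⟩
  rw [h₀.weights_eq] at hKw
  have hKweight : K.weight = G.weight + G'.weight := weight_of_append hKw
  have hKc := hKB
  rw [halfEdges, hKweight, hcompl] at hKc
  have hl := isPart_part (isSaturated_left_of_append hKw)
  have hr := isPart_part (isSaturated_right_of_append hKw)
  have hlw := weights_left_of_append hKw hl
  have hrw := weights_right_of_append hKw hr
  change IsPart K (Finset.Ioc 0 G.weight) (K.part (Finset.Ioc 0 G.weight)) at hl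
  change IsPart K (Finset.Ioc G.weight (G.weight + G'.weight))
    (K.part (Finset.Ioc G.weight (G.weight + G'.weight))) at hr
  -- The left block has the weights of `G`. Its restriction to `S` is the left block of `A`, that is
  -- `G.part S`, and its restriction to the complement is the left block of `B`; `eq_of_isPart`
  -- concludes.
  have eql : K.part (Finset.Ioc 0 G.weight) = G := by
    refine eq_of_isPart hlw (S := S) (A := G.part S) (B := G.part (G.halfEdges \ S)) ?_ hS ?_
      (isPart_of_mem hS) ?_ (isPart_of_mem (compl_mem_closedSets hS))
    · have := hl.restrictTo_mem_closedSets hKS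
      rwa [hJl] at this
    · rw [← hJl, hl.isPart_restrictTo_iff, Finset.inter_comm, ← hKA.isPart_restrictTo_iff,
        restrictTo_left hJsub, ← card_restrictTo, hJl, ← (isPart_of_mem hS).weight_eq]
      exact hA.left
    · rw [show (K.part (Finset.Ioc 0 G.weight)).halfEdges = G.halfEdges by
        rw [halfEdges, halfEdges, hl.weight_eq, Nat.card_Ioc, Nat.sub_zero]]
      conv => arg 2; rw [← hCl]
      rw [hl.isPart_restrictTo_iff, Finset.inter_comm, ← hKc.isPart_restrictTo_iff,
        restrictTo_left hCsub, ← card_restrictTo, hCl,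
        ← (isPart_of_mem (compl_mem_closedSets hS)).weight_eq]
      exact hB.left
  have eqr : K.part (Finset.Ioc G.weight (G.weight + G'.weight)) = G' := by
    refine eq_of_isPart hrw (S := S') (A := G'.part S') (B := G'.part (G'.halfEdges \ S')) ?_ hS' ?_
      (isPart_of_mem hS') ?_ (isPart_of_mem (compl_mem_closedSets hS'))
    · have := hr.restrictTo_mem_closedSets hKS
      rwa [hJr] at this
    · conv => arg 2; rw [← hJr]
      rw [hr.isPart_restrictTo_iff, Finset.inter_comm, ← hKA.isPart_restrictTo_iff,
        restrictTo_right hJsub, ← card_restrictTo, ← card_restrictTo, hJl, hJr,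
        ← (isPart_of_mem hS).weight_eq, ← (isPart_of_mem hS').weight_eq]
      exact hA.right
    · rw [show (K.part (Finset.Ioc G.weight (G.weight + G'.weight))).halfEdges = G'.halfEdges by
        rw [halfEdges, halfEdges, hr.weight_eq, Nat.card_Ioc, Nat.add_sub_cancel_left]]
      conv => arg 2; rw [← hCr]
      rw [hr.isPart_restrictTo_iff, Finset.inter_comm, ← hKc.isPart_restrictTo_iff,
        restrictTo_right hCsub, ← card_restrictTo, ← card_restrictTo, hCl, hCr,
        ← (isPart_of_mem (compl_mem_closedSets hS)).weight_eq,
        ← (isPart_of_mem (compl_mem_closedSets hS')).weight_eq]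
      exact hB.right
  rw [eql] at hl
  rw [eqr] at hr
  exact ⟨hKw, hl, hr⟩

/-- A pair `(K, S)` corresponds to the traces of `S` on the two factors together with the two
restrictions of `K`. Injectivity: the traces give `S`, then the weights and the restrictions give
`K` by `eq_of_isPart`. Surjectivity is `exists_isComp_of_parts`. -/
theorem sum_comps_closedSets {M : Type*} [AddCommMonoid M] (G G' : BDiagram)
    (F : BDiagram → BDiagram → M) :
    ∑ K ∈ G.comps G', ∑ S ∈ K.closedSets, F (K.part S) (K.part (K.halfEdges \ S)) =
      ∑ p ∈ G.closedSets ×ˢ G'.closedSets,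
        ∑ q ∈ (G.part p.1).comps (G'.part p.2) ×ˢ
          (G.part (G.halfEdges \ p.1)).comps (G'.part (G'.halfEdges \ p.2)), F q.1 q.2 := by
  rw [Finset.sum_sigma', Finset.sum_sigma']
  refine Finset.sum_bij (fun x _ => ⟨(restrictTo (Finset.Ioc 0 G.weight) x.2,
    restrictTo (Finset.Ioc G.weight (G.weight + G'.weight)) x.2),
    (x.1.part x.2, x.1.part (x.1.halfEdges \ x.2))⟩) ?_ ?_ ?_ ?_
  · rintro ⟨K, S⟩ h
    simp only [Finset.mem_sigma, Finset.mem_product, mem_comps] at h ⊢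
    refine ⟨⟨h.1.left.restrictTo_mem_closedSets h.2, h.1.right.restrictTo_mem_closedSets h.2⟩,
      h.1.part h.2, ?_⟩
    rw [← h.1.left.restrictTo_compl, ← h.1.right.restrictTo_compl]
    exact h.1.part (compl_mem_closedSets h.2)
  · rintro ⟨K, S⟩ h ⟨K', S'⟩ h' heq
    simp only [Finset.mem_sigma, mem_comps] at h h'
    simp only [Sigma.mk.injEq, Prod.mk.injEq, heq_eq_eq] at heq
    obtain ⟨⟨h1, h2⟩, h3, h4⟩ := heq
    have hSS : S = S' := by
      rw [← joinSets_restrictTo (subset_Ioc_of_mem_closedSets h.2 h.1.weight_eq), h1, h2,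
        joinSets_restrictTo (subset_Ioc_of_mem_closedSets h'.2 h'.1.weight_eq)]
    subst hSS
    have hKK : K = K' := by
      refine eq_of_isPart ?_ h.2 h'.2 (isPart_of_mem h.2) ?_
        (isPart_of_mem (compl_mem_closedSets h.2)) ?_
      · rw [h.1.weights_eq, h'.1.weights_eq]
      · rw [h3]
        exact isPart_of_mem h'.2
      · rw [h4]
        exact isPart_of_mem (compl_mem_closedSets h'.2)
    rw [hKK]
  · rintro ⟨⟨S, S'⟩, A, B⟩ h
    simp only [Finset.mem_sigma, Finset.mem_product, mem_comps] at h
    obtain ⟨⟨hS, hS'⟩, hA, hB⟩ := h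
    obtain ⟨K, hK, hJ, hKA, hKB⟩ := exists_isComp_of_parts hS hS' hA hB
    refine ⟨⟨K, joinSets G.weight S S'⟩, ?_, ?_⟩
    · simp only [Finset.mem_sigma, mem_comps]
      exact ⟨hK, hJ⟩
    · simp only
      rw [restrictTo_left_joinSets (mem_closedSets.1 hS).1 (mem_closedSets.1 hS').1,
        restrictTo_right_joinSets (mem_closedSets.1 hS).1 (mem_closedSets.1 hS').1,
        part_eq (isSaturated_of_mem hJ) hKA,
        part_eq (isSaturated_of_mem (compl_mem_closedSets hJ)) hKB]
  · intros
    rfl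

/-! ### The empty diagram, symmetries of closed sets, finiteness. -/

/-- Without half-edges `ext_of_vertex` has nothing to compare. Connectedness of the grading rests on
this. -/
theorem weight_eq_zero_iff {G : BDiagram} : G.weight = 0 ↔ G = empty := by
  constructor
  · intro h
    have hh : G.halfEdges = ∅ := by rw [halfEdges, h]; rfl
    apply ext_of_vertex h <;> simp [hh]
  · rintro rfl
    rfl

theorem part_eq_empty_iff {G : BDiagram} {S : Finset ℕ} (hS : S ∈ G.closedSets) :
    G.part S = empty ↔ S = ∅ := by
  rw [← weight_eq_zero_iff, (isPart_of_mem hS).weight_eq, Finset.card_eq_zero]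

theorem part_empty (G : BDiagram) : G.part ∅ = empty :=
  (part_eq_empty_iff G.empty_mem_closedSets).2 rfl

theorem part_halfEdges (G : BDiagram) : G.part G.halfEdges = G :=
  part_eq (isSaturated_of_mem G.halfEdges_mem_closedSets) G.isPart_halfEdges

theorem isComp_empty_left {K G : BDiagram} : IsComp K empty G ↔ K = G := by
  constructor
  · intro h
    have hw := h.weight_eq
    have := h.right
    rw [← hw, weight_eq_zero_iff.2 rfl, ← Icc_one_eq_Ioc] at this
    exact (isPart_halfEdges K).unique this
  · rintro rfl
    apply IsComp.mk' <;> simp [empty, halfEdges, weight]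

theorem isComp_empty_right {K G : BDiagram} : IsComp K G empty ↔ K = G := by
  constructor
  · intro h
    have hw := h.weight_eq
    have := h.left
    rw [weight_eq_zero_iff.2 rfl, Nat.add_zero] at hw
    rw [← hw, ← Icc_one_eq_Ioc] at this
    exact (isPart_halfEdges K).unique this
  · rintro rfl
    apply IsComp.mk' <;> simp [empty, halfEdges, weight]

theorem comps_empty_left (G : BDiagram) : empty.comps G = {G} := by
  ext K
  rw [mem_comps, isComp_empty_left, Finset.mem_singleton]

theorem comps_empty_right (G : BDiagram) : G.comps empty = {G} := by
  ext K
  rw [mem_comps, isComp_empty_right, Finset.mem_singleton]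

theorem sum_closedSets_compl {M : Type*} [AddCommMonoid M] (G : BDiagram)
    (F : BDiagram → BDiagram → M) :
    ∑ S ∈ G.closedSets, F (G.part (G.halfEdges \ S)) (G.part S) =
      ∑ S ∈ G.closedSets, F (G.part S) (G.part (G.halfEdges \ S)) := by
  refine Finset.sum_bij' (fun S _ => G.halfEdges \ S) (fun S _ => G.halfEdges \ S) ?_ ?_ ?_ ?_ ?_
  · exact fun S hS => compl_mem_closedSets hS
  · exact fun S hS => compl_mem_closedSets hS
  · exact fun S hS => Finset.sdiff_sdiff_eq_self (mem_closedSets.1 hS).1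
  · exact fun S hS => Finset.sdiff_sdiff_eq_self (mem_closedSets.1 hS).1
  · intro S hS
    rw [Finset.sdiff_sdiff_eq_self (mem_closedSets.1 hS).1]

/-- Both sides run over the ordered partitions of the half-edges into three closed sets: a chain `T
⊆ S` corresponds to `T`, `S \ T` and the complement of `S`. -/
theorem sum_closedSets_assoc {M : Type*} [AddCommMonoid M] (G : BDiagram)
    (F : BDiagram → BDiagram → BDiagram → M) :
    ∑ S ∈ G.closedSets, ∑ T ∈ G.closedSets with T ⊆ S,
        F (G.part T) (G.part (S \ T)) (G.part (G.halfEdges \ S)) =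
      ∑ S ∈ G.closedSets, ∑ T ∈ G.closedSets with T ⊆ G.halfEdges \ S,
        F (G.part S) (G.part T) (G.part ((G.halfEdges \ S) \ T)) := by
  rw [Finset.sum_sigma', Finset.sum_sigma']
  refine Finset.sum_bij' (fun p _ => ⟨p.2, p.1 \ p.2⟩) (fun p _ => ⟨p.1 ∪ p.2, p.1⟩) ?_ ?_ ?_ ?_ ?_
  · rintro ⟨S, T⟩ h
    simp only [Finset.mem_sigma, Finset.mem_filter] at h ⊢
    exact ⟨h.2.1, sdiff_mem_closedSets h.1 h.2.1,
      Finset.sdiff_subset_sdiff (mem_closedSets.1 h.1).1 subset_rfl⟩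
  · rintro ⟨S, T⟩ h
    simp only [Finset.mem_sigma, Finset.mem_filter] at h ⊢
    exact ⟨union_mem_closedSets h.1 h.2.1, h.1, Finset.subset_union_left⟩
  · rintro ⟨S, T⟩ h
    simp only [Finset.mem_sigma, Finset.mem_filter] at h
    simp [Finset.union_eq_right.2 h.2.2]
  · rintro ⟨S, T⟩ h
    simp only [Finset.mem_sigma, Finset.mem_filter] at h
    have hd : Disjoint T S := Finset.disjoint_of_subset_left h.2.2 Finset.sdiff_disjoint
    simp [Finset.union_sdiff_left, Finset.sdiff_eq_self_of_disjoint hd]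
  · rintro ⟨S, T⟩ h
    simp only [Finset.mem_sigma, Finset.mem_filter] at h
    simp only
    rw [Finset.sdiff_sdiff_left', ← Finset.sdiff_union_distrib, Finset.union_sdiff_of_subset h.2.2]

/-- The weights are the blocks of a composition of `k`, and the other data are subsets of fixed
finite sets. -/
theorem finite_setOf_weight_eq (k : ℕ) : {G : BDiagram | G.weight = k}.Finite := by
  let f : BDiagram → List ℕ × Finset ℕ × Finset ℕ × Finset (ℕ × ℕ) :=
    fun G => (G.weights, G.outer, G.inner, G.edges)
  have hf : Function.Injective f := by
    intro G H h
    simp only [f, Prod.mk.injEq] at h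
    exact BDiagram.ext h.1 h.2.1 h.2.2.1 h.2.2.2
  let W := Finset.Icc 1 k
  refine Set.Finite.of_finite_image (f := f) ?_ hf.injOn
  refine ((Set.finite_range (Composition.blocks (n := k))).prod
    (W.powerset.finite_toSet.prod (W.powerset.finite_toSet.prod
      (W ×ˢ W).powerset.finite_toSet))).subset ?_
  rintro _ ⟨G, rfl, rfl⟩
  refine ⟨⟨⟨G.weights, fun h => G.weights_pos _ h, rfl⟩, rfl⟩, ?_, ?_, ?_⟩
  · exact Finset.mem_powerset.2 G.outer_subset
  · exact Finset.mem_powerset.2 G.inner_subset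
  · refine Finset.mem_powerset.2 fun e he => Finset.mem_product.2 ?_
    exact mem_halfEdges_of_mem_edges he

end BDiagram

/-! ### The bialgebra structure. -/

namespace BSpace

open scoped TensorProduct
open BDiagram

theorem star_basis (G G' : BDiagram) :
    star (basis G) (basis G') = ∑ K ∈ G.comps G', basis K := by
  rw [star, Module.Basis.constr_basis, Module.Basis.constr_basis, sum_branchings]

theorem coproduct_basis (G : BDiagram) : coproduct (basis G) =
    ∑ S ∈ G.closedSets, basis (G.part S) ⊗ₜ[ℂ] basis (G.part (G.halfEdges \ S)) := by
  rw [coproduct, Module.Basis.constr_basis]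
  exact G.sum_isolated fun A B => basis A ⊗ₜ[ℂ] basis B

theorem counit_basis_empty : counit (basis empty) = 1 := by
  simp [counit]

theorem counit_basis_of_ne {G : BDiagram} (h : G ≠ empty) : counit (basis G) = 0 := by
  rw [counit, Module.Basis.coord_apply, Module.Basis.repr_self,
    Finsupp.single_eq_of_ne h.symm]

theorem induction_on_basis {P : BSpace → Prop} (x : BSpace) (basis : ∀ G, P (basis G))
    (zero : P 0) (add : ∀ x y, P x → P y → P (x + y)) (smul : ∀ (c : ℂ) x, P x → P (c • x)) :
    P x := by
  refine Submodule.span_induction (p := fun x _ => P x) ?_ zero (fun x y _ _ => add x y)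
    (fun c x _ => smul c x) (BSpace.basis.mem_span x)
  rintro _ ⟨G, rfl⟩
  exact basis G

theorem star_assoc (x y z : BSpace) : star (star x y) z = star x (star y z) := by
  induction x using induction_on_basis with
  | basis G =>
    induction y using induction_on_basis with
    | basis G' =>
      induction z using induction_on_basis with
      | basis G'' =>
        simp only [star_basis, map_sum, LinearMap.sum_apply]
        exact sum_comps_assoc G G' G'' fun L => basis L
      | zero => simp only [map_zero]
      | add x y hx hy => simp only [map_add, hx, hy]
      | smul c x hx => simp only [map_smul, hx]
    | zero => simp only [map_zero, LinearMap.zero_apply]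
    | add x y hx hy => simp only [map_add, LinearMap.add_apply, hx, hy]
    | smul c x hx => simp only [map_smul, LinearMap.smul_apply, hx]
  | zero => simp only [map_zero, LinearMap.zero_apply]
  | add x y hx hy => simp only [map_add, LinearMap.add_apply, hx, hy]
  | smul c x hx => simp only [map_smul, LinearMap.smul_apply, hx]

theorem unit_star (x : BSpace) : star unit x = x := by
  have h : star unit = LinearMap.id := basis.ext fun G => by
    rw [unit, star_basis, comps_empty_left, Finset.sum_singleton, LinearMap.id_apply]
  rw [h, LinearMap.id_apply]

theorem star_unit (x : BSpace) : star x unit = x := by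
  have h : star.flip unit = LinearMap.id := basis.ext fun G => by
    rw [LinearMap.flip_apply, unit, star_basis, comps_empty_right, Finset.sum_singleton,
      LinearMap.id_apply]
  rw [← LinearMap.flip_apply, h, LinearMap.id_apply]

/-- The ring structure with product `⋆`. -/
@[reducible] noncomputable def ring : Ring BSpace :=
  { instAddCommGroup with
    mul := fun x y => star x y
    one := unit
    left_distrib := fun x y z => map_add (star x) y z
    right_distrib := fun x y z => LinearMap.map_add₂ star x y z
    zero_mul := fun x => LinearMap.map_zero₂ star x
    mul_zero := fun x => map_zero (star x)
    mul_assoc := star_assoc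
    one_mul := unit_star
    mul_one := star_unit }

attribute [local instance] ring

theorem one_def : (1 : BSpace) = basis empty := rfl

theorem basis_mul_basis (G G' : BDiagram) :
    basis G * basis G' = ∑ K ∈ G.comps G', basis K :=
  star_basis G G'

/-- The algebra structure with product `⋆`. -/
@[reducible] noncomputable def algebra : Algebra ℂ BSpace :=
  Algebra.ofModule (fun c x y => LinearMap.map_smul₂ star c x y) (fun c x y => map_smul (star x) c y)

attribute [local instance] algebra

/-- Both sides are turned by `sum_closedSets_part` into sums over pairs of closed sets of `G`, which
`sum_closedSets_assoc` matches. -/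
theorem coassoc_basis (G : BDiagram) :
    TensorProduct.assoc ℂ BSpace BSpace BSpace (coproduct.rTensor BSpace (coproduct (basis G))) =
      coproduct.lTensor BSpace (coproduct (basis G)) := by
  simp only [coproduct_basis, map_sum, LinearMap.rTensor_tmul, LinearMap.lTensor_tmul,
    TensorProduct.sum_tmul, TensorProduct.tmul_sum, TensorProduct.assoc_tmul]
  have hl : ∀ S ∈ G.closedSets, ∑ T ∈ (G.part S).closedSets,
      basis ((G.part S).part T) ⊗ₜ[ℂ] (basis ((G.part S).part ((G.part S).halfEdges \ T)) ⊗ₜ[ℂ]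
        basis (G.part (G.halfEdges \ S))) = _ := fun S hS =>
    sum_closedSets_part hS fun A B =>
      basis A ⊗ₜ[ℂ] (basis B ⊗ₜ[ℂ] basis (G.part (G.halfEdges \ S)))
  have hr : ∀ S ∈ G.closedSets, ∑ T ∈ (G.part (G.halfEdges \ S)).closedSets,
      basis (G.part S) ⊗ₜ[ℂ] (basis ((G.part (G.halfEdges \ S)).part T) ⊗ₜ[ℂ]
        basis ((G.part (G.halfEdges \ S)).part ((G.part (G.halfEdges \ S)).halfEdges \ T))) = _ :=
    fun S hS => sum_closedSets_part (compl_mem_closedSets hS) fun A B =>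
      basis (G.part S) ⊗ₜ[ℂ] (basis A ⊗ₜ[ℂ] basis B)
  rw [Finset.sum_congr rfl hl, Finset.sum_congr rfl hr]
  exact G.sum_closedSets_assoc fun A B C => basis A ⊗ₜ[ℂ] (basis B ⊗ₜ[ℂ] basis C)

theorem comm_coproduct_basis (G : BDiagram) :
    TensorProduct.comm ℂ BSpace BSpace (coproduct (basis G)) = coproduct (basis G) := by
  simp only [coproduct_basis, map_sum, TensorProduct.comm_tmul]
  exact G.sum_closedSets_compl fun A B => basis A ⊗ₜ[ℂ] basis B

/-- The counit kills every nonempty diagram, so only `S = ∅` contributes. -/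
theorem rTensor_counit_coproduct_basis (G : BDiagram) :
    counit.rTensor BSpace (coproduct (basis G)) = 1 ⊗ₜ[ℂ] basis G := by
  simp only [coproduct_basis, map_sum, LinearMap.rTensor_tmul]
  rw [Finset.sum_eq_single_of_mem ∅ G.empty_mem_closedSets]
  · rw [part_empty, counit_basis_empty, Finset.sdiff_empty, part_halfEdges]
  · intro S hS hne
    rw [counit_basis_of_ne (mt (part_eq_empty_iff hS).1 hne), TensorProduct.zero_tmul]

theorem lTensor_counit_coproduct_basis (G : BDiagram) :
    counit.lTensor BSpace (coproduct (basis G)) = basis G ⊗ₜ[ℂ] 1 := by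
  simp only [coproduct_basis, map_sum, LinearMap.lTensor_tmul]
  -- Passing to complements makes `∅` the surviving index on this side too.
  rw [← G.sum_closedSets_compl fun A B => basis A ⊗ₜ[ℂ] counit (basis B),
    Finset.sum_eq_single_of_mem ∅ G.empty_mem_closedSets]
  · rw [part_empty, counit_basis_empty, Finset.sdiff_empty, part_halfEdges]
  · intro S hS hne
    rw [counit_basis_of_ne (mt (part_eq_empty_iff hS).1 hne), TensorProduct.tmul_zero]

/-- The coalgebra structure with coproduct `Δ`. -/
@[reducible] noncomputable def coalgebra : Coalgebra ℂ BSpace where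
  comul := coproduct
  counit := counit
  coassoc := basis.ext coassoc_basis
  rTensor_counit_comp_comul := basis.ext rTensor_counit_coproduct_basis
  lTensor_counit_comp_comul := basis.ext lTensor_counit_coproduct_basis

attribute [local instance] coalgebra

theorem comul_def (x : BSpace) : Coalgebra.comul (R := ℂ) x = coproduct x := rfl

theorem counit_def (x : BSpace) : Coalgebra.counit (R := ℂ) x = counit x := rfl

theorem isCocomm : Coalgebra.IsCocomm ℂ BSpace :=
  ⟨basis.ext comm_coproduct_basis⟩

/-- If `G` is not empty, every composition has positive weight, so both sides vanish. -/
theorem counit_basis_mul_basis (G G' : BDiagram) :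
    counit (basis G * basis G') = counit (basis G) * counit (basis G') := by
  rw [basis_mul_basis, map_sum]
  by_cases h : G = empty
  · subst h
    rw [comps_empty_left, Finset.sum_singleton, counit_basis_empty, one_mul]
  · rw [counit_basis_of_ne h, zero_mul]
    refine Finset.sum_eq_zero fun K hK => counit_basis_of_ne ?_
    rintro rfl
    have := (mem_comps.1 hK).weight_eq
    rw [weight_eq_zero_iff.2 rfl] at this
    exact h (weight_eq_zero_iff.1 (by omega))

theorem coproduct_basis_mul_basis (G G' : BDiagram) :
    coproduct (basis G * basis G') = coproduct (basis G) * coproduct (basis G') := by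
  rw [basis_mul_basis, map_sum]
  simp only [coproduct_basis]
  rw [G.sum_comps_closedSets G' fun A B => basis A ⊗ₜ[ℂ] basis B, Finset.sum_mul_sum,
    Finset.sum_product]
  refine Finset.sum_congr rfl fun S _ => Finset.sum_congr rfl fun S' _ => ?_
  rw [Algebra.TensorProduct.tmul_mul_tmul, basis_mul_basis, basis_mul_basis,
    TensorProduct.sum_tmul, Finset.sum_product]
  exact Finset.sum_congr rfl fun A _ => by rw [TensorProduct.tmul_sum]

/-- The bialgebra of B-diagrams. -/
@[reducible] noncomputable def bialgebra : Bialgebra ℂ BSpace where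
  counit_one := counit_basis_empty
  mul_compr₂_counit := basis.ext fun G => basis.ext fun G' => counit_basis_mul_basis G G'
  comul_one := by
    rw [one_def, comul_def, coproduct_basis,
      show empty.closedSets = {∅} from rfl, Finset.sum_singleton, part_empty,
      Finset.sdiff_empty, part_halfEdges]
    rfl
  mul_compr₂_comul := basis.ext fun G => basis.ext fun G' => coproduct_basis_mul_basis G G'

attribute [local instance] bialgebra

/-! ### The antipode -/

/-- Makes the recursion for convolution inverses well-founded. -/
theorem weight_part_lt {G : BDiagram} {S : Finset ℕ}
    (hS : S ∈ G.closedSets.filter (· ≠ G.halfEdges)) : (G.part S).weight < G.weight := by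
  rw [Finset.mem_filter] at hS
  rw [(isPart_of_mem hS.1).weight_eq, ← G.card_halfEdges]
  exact Finset.card_lt_card (lt_of_le_of_ne (mem_closedSets.1 hS.1).1 hS.2)

open Classical in
/-- The values on diagrams of the left inverse of `f` for the convolution product. -/
noncomputable def convInvBasis (f : BSpace →ₗ[ℂ] BSpace) (G : BDiagram) : BSpace :=
  if G = empty then 1 else
    -∑ S ∈ (G.closedSets.filter (· ≠ G.halfEdges)).attach,
      convInvBasis f (G.part S.1) * f (basis (G.part (G.halfEdges \ S.1)))
termination_by G.weight
decreasing_by exact weight_part_lt S.2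

/-- The left inverse of `f` for the convolution product. -/
noncomputable def convInv (f : BSpace →ₗ[ℂ] BSpace) : BSpace →ₗ[ℂ] BSpace :=
  basis.constr ℂ (convInvBasis f)

theorem convInv_basis_empty (f : BSpace →ₗ[ℂ] BSpace) : convInv f (basis empty) = 1 := by
  rw [convInv, Module.Basis.constr_basis, convInvBasis, if_pos rfl]

theorem convInv_basis_of_ne (f : BSpace →ₗ[ℂ] BSpace) {G : BDiagram} (h : G ≠ empty) :
    convInv f (basis G) = -∑ S ∈ G.closedSets with S ≠ G.halfEdges,
      convInv f (basis (G.part S)) * f (basis (G.part (G.halfEdges \ S))) := by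
  simp only [convInv, Module.Basis.constr_basis]
  rw [convInvBasis, if_neg h]
  exact congrArg _ (Finset.sum_attach _ fun S =>
    convInvBasis f (G.part S) * f (basis (G.part (G.halfEdges \ S))))

open WithConv in
-- In the convolution product at `G`, the term of the full set of half-edges is `convInv f` at `G`
-- times `f` at the empty diagram, which is 1; the recursion is chosen so that this term cancels all
-- the others.
theorem toConv_convInv_mul {f : BSpace →ₗ[ℂ] BSpace} (hf : f (basis empty) = 1) :
    toConv (convInv f) * toConv f = 1 := by
  rw [LinearMap.convMul_def, LinearMap.convOne_def]
  refine congrArg _ (basis.ext fun G => ?_)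
  simp only [LinearMap.comp_apply, comul_def, counit_def, coproduct_basis, map_sum,
    TensorProduct.map_tmul, LinearMap.mul'_apply, Algebra.linearMap_apply]
  by_cases h : G = empty
  · subst h
    rw [show empty.closedSets = {∅} from rfl, Finset.sum_singleton, part_empty,
      Finset.sdiff_empty, part_halfEdges, hf, convInv_basis_empty, counit_basis_empty, map_one,
      one_mul]
  · rw [counit_basis_of_ne h, map_zero,
      ← Finset.sum_filter_add_sum_filter_not _ (· ≠ G.halfEdges)]
    have : G.closedSets.filter (fun S => ¬ S ≠ G.halfEdges) = {G.halfEdges} := by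
      ext S
      simp only [Finset.mem_filter, not_not, Finset.mem_singleton]
      exact ⟨fun hS => hS.2, fun hS => ⟨hS ▸ G.halfEdges_mem_closedSets, hS⟩⟩
    rw [this, Finset.sum_singleton, part_halfEdges, Finset.sdiff_self, part_empty, hf, mul_one,
      convInv_basis_of_ne f h, add_neg_cancel]

/-- The antipode. -/
noncomputable def antipode : BSpace →ₗ[ℂ] BSpace := convInv LinearMap.id

open WithConv in
theorem toConv_antipode_mul_id : toConv antipode * toConv (LinearMap.id : BSpace →ₗ[ℂ] BSpace) = 1 :=
  toConv_convInv_mul rfl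

open WithConv in
-- The antipode sends the empty diagram to 1, so it has a left inverse for convolution. The identity
-- being a right inverse of it, the two coincide by associativity.
theorem toConv_id_mul_antipode :
    toConv (LinearMap.id : BSpace →ₗ[ℂ] BSpace) * toConv antipode = 1 := by
  have h := toConv_convInv_mul (f := antipode) (convInv_basis_empty _)
  rwa [left_inv_eq_right_inv h toConv_antipode_mul_id] at h

/-- The Hopf algebra of B-diagrams. -/
@[reducible] noncomputable def hopfAlgebra : HopfAlgebra ℂ BSpace where
  antipode := antipode
  mul_antipode_rTensor_comul := congrArg WithConv.ofConv toConv_antipode_mul_id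
  mul_antipode_lTensor_comul := congrArg WithConv.ofConv toConv_id_mul_antipode

attribute [local instance] hopfAlgebra

/-! ### The grading -/

theorem basis_mem_component (G : BDiagram) : basis G ∈ component G.weight :=
  Submodule.subset_span ⟨G, rfl, rfl⟩

theorem map_mem_of_mem_component {N : Type*} [AddCommMonoid N] [Module ℂ N] (f : BSpace →ₗ[ℂ] N)
    (P : Submodule ℂ N) {k : ℕ} (h : ∀ G : BDiagram, G.weight = k → f (basis G) ∈ P) {x : BSpace}
    (hx : x ∈ component k) : f x ∈ P := by
  have : component k ≤ P.comap f := by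
    rw [component, Submodule.span_le]
    rintro _ ⟨G, hG, rfl⟩
    exact h G hG
  exact this hx

theorem basis_mul_basis_mem (G G' : BDiagram) :
    basis G * basis G' ∈ component (G.weight + G'.weight) := by
  rw [basis_mul_basis]
  refine Submodule.sum_mem _ fun K hK => ?_
  rw [← (mem_comps.1 hK).weight_eq]
  exact basis_mem_component K

theorem mul_mem_component {i j : ℕ} {x y : BSpace} (hx : x ∈ component i) (hy : y ∈ component j) :
    x * y ∈ component (i + j) := by
  refine map_mem_of_mem_component (star.flip y) _ (fun G hG => ?_) hx
  refine map_mem_of_mem_component (star (basis G)) _ (fun G' hG' => ?_) hy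
  rw [← hG, ← hG']
  exact basis_mul_basis_mem G G'

theorem weight_part_add {G : BDiagram} {S : Finset ℕ} (hS : S ∈ G.closedSets) :
    (G.part S).weight + (G.part (G.halfEdges \ S)).weight = G.weight := by
  rw [(isPart_of_mem hS).weight_eq, (isPart_of_mem (compl_mem_closedSets hS)).weight_eq,
    add_comm, Finset.card_sdiff_add_card_eq_card (mem_closedSets.1 hS).1, G.card_halfEdges]

/-- Induction along the recursion: in each term the weights of the two complementary restrictions
add up to that of `G`. -/
theorem antipode_basis_mem (G : BDiagram) : antipode (basis G) ∈ component G.weight := by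
  induction h : G.weight using Nat.strong_induction_on generalizing G with
  | _ n ih =>
    subst h
    by_cases hG : G = empty
    · rw [hG, antipode, convInv_basis_empty]
      exact basis_mem_component empty
    · rw [antipode, convInv_basis_of_ne _ hG]
      refine neg_mem (Submodule.sum_mem _ fun S hS => ?_)
      rw [← weight_part_add (Finset.mem_filter.1 hS).1]
      exact mul_mem_component (ih _ (weight_part_lt hS) _ rfl) (basis_mem_component _)

theorem isInternal_component : DirectSum.IsInternal component := by
  refine DirectSum.isInternal_submodule_of_iSupIndep_of_iSup_eq_top ?_ ?_
  · intro k
    -- The other components are spanned by basis vectors with indices disjoint from those of weight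
    -- `k`, and linear independence separates the two spans.
    have hle : ⨆ j, ⨆ _ : j ≠ k, component j ≤ Submodule.span ℂ (basis '' {G | G.weight ≠ k}) := by
      refine iSup₂_le fun j hj => Submodule.span_mono (Set.image_mono fun G hG => ?_)
      exact fun h => hj (hG.symm.trans h)
    refine Disjoint.mono_right hle (basis.linearIndependent.disjoint_span_image ?_)
    rw [Set.disjoint_left]
    exact fun G h h' => h' h
  · rw [eq_top_iff, ← basis.span_eq, Submodule.span_le]
    rintro _ ⟨G, rfl⟩
    exact Submodule.mem_iSup_of_mem G.weight (basis_mem_component G)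

theorem isHopfGrading_component : IsHopfGrading component where
  isInternal := isInternal_component
  gradedMonoid :=
    { one_mem := basis_mem_component empty
      mul_mem := fun _ _ _ _ hx hy => mul_mem_component hx hy }
  comul_mem := by
    intro k x hx
    refine map_mem_of_mem_component coproduct _ (fun G hG => ?_) hx
    rw [coproduct_basis]
    refine Submodule.sum_mem _ fun S hS => ?_
    refine Submodule.mem_iSup_of_mem
      ((G.part S).weight, (G.part (G.halfEdges \ S)).weight) ?_
    refine Submodule.mem_iSup_of_mem
      (Finset.HasAntidiagonal.mem_antidiagonal.2 ((weight_part_add hS).trans hG)) ?_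
    exact ⟨⟨_, basis_mem_component _⟩ ⊗ₜ[ℂ] ⟨_, basis_mem_component _⟩, rfl⟩
  counit_eq_zero := by
    intro k hk x hx
    have := map_mem_of_mem_component counit ⊥ (fun G hG => ?_) hx
    · exact (Submodule.mem_bot ℂ).1 this
    · refine (Submodule.mem_bot ℂ).2 (counit_basis_of_ne ?_)
      rintro rfl
      exact hk hG.symm
  antipode_mem := by
    intro k x hx
    refine map_mem_of_mem_component antipode _ (fun G hG => ?_) hx
    rw [← hG]
    exact antipode_basis_mem G

theorem finiteDimensional_component (k : ℕ) : FiniteDimensional ℂ (component k) :=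
  FiniteDimensional.span_of_finite ℂ ((finite_setOf_weight_eq k).image _)

theorem finrank_component_zero : Module.finrank ℂ (component 0) = 1 := by
  have h : {G : BDiagram | G.weight = 0} = {empty} := by
    ext G
    exact weight_eq_zero_iff
  rw [component, h, Set.image_singleton]
  exact finrank_span_singleton (basis.ne_zero empty)

end BSpace

/-- `(𝓑, ⋆, Δ)` is a graded Hopf algebra, connected and cocommutative, with finite-dimensional
graded components: there is a Hopf algebra `A` and a linear isomorphism `e : 𝓑 ≃ A` carrying `⋆`,
the empty diagram, `Δ` and the counit of `𝓑` to the product, unit, coproduct and counit of `A`. -/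
theorem mainTheorem1 :
    ∃ (A : Type) (_ : Ring A) (_ : HopfAlgebra ℂ A) (e : BSpace ≃ₗ[ℂ] A),
      (∀ x y : BSpace, e (BSpace.star x y) = e x * e y) ∧
      e BSpace.unit = 1 ∧
      (∀ x : BSpace, Coalgebra.comul (R := ℂ) (e x) =
        TensorProduct.map e.toLinearMap e.toLinearMap (BSpace.coproduct x)) ∧
      (∀ x : BSpace, Coalgebra.counit (R := ℂ) (e x) = BSpace.counit x) ∧
      IsHopfGrading (fun k => (BSpace.component k).map e.toLinearMap) ∧
      Coalgebra.IsCocomm ℂ A ∧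
      Module.finrank ℂ (BSpace.component 0) = 1 ∧
      ∀ k : ℕ, FiniteDimensional ℂ (BSpace.component k) := by
  -- The Hopf algebra is the space itself and `e` is the identity; only the maps induced by `e` on
  -- tensors and on submodules need simplification.
  refine ⟨BSpace, BSpace.ring, BSpace.hopfAlgebra, LinearEquiv.refl ℂ BSpace,
    fun _ _ => rfl, rfl, fun x => ?_, fun _ => rfl, ?_, BSpace.isCocomm,
    BSpace.finrank_component_zero, BSpace.finiteDimensional_component⟩
  · rw [LinearEquiv.refl_toLinearMap, TensorProduct.map_id]
    rfl
  · simp only [LinearEquiv.refl_toLinearMap, Submodule.map_id]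
    exact BSpace.isHopfGrading_component
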